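/- **Setting.** On $\mathbb R^4$, with its standard scalar product $\langle\cdot,\cdot\rangle$, let $\omega=dx^1\wedge dx^2+dx^3\wedge dx^4$ and let $J$ be the complex structure with $\omega(x,y)=\langle Jx,y\rangle$. Write $\epsilon_1,\dots,\epsilon_4$ for the standard basis. Identify $\mathbb R^4$ with the quaternions by $x\mapsto x^1+ix^2+jx^3+kx^4$, and let $L_q$, $R_q$ be the matrices of left and right multiplication by $q$; thus $J=L_i$. Let $\mathcal G$ be the group of affine transformations $(G,T):x\mapsto Gx+T$ of $\mathbb R^4$ that preserve $\langle\cdot,\cdot\rangle$ and $\omega$, regarded as the group of matrices $\begin{pmatrix}G&T\\0&1\end{pmatrix}$. Let $\mathfrak g=\{(aL_i+b^1R_i+b^2R_j+b^3R_k,\,t)\}$ be its Lie algebra, and let $\mathcal G_0=\{R_{\bar q}: |q|=1\}\simeq SU(2)$. Conjugation by $(-L_j,0)$ induces an automorphism $\tau$ of $\mathfrak g^{\mathbb C}=\mathfrak g\otimes\mathbb C$ with $\tau^4=1$. For $k\in\{-1,0,1,2\}$ let $[\cdot]_k$ be the projection onto its eigenspace for the eigenvalue $i^k$, along the other eigenspaces.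 Let $\Omega\subset\mathbb C$ be a simply connected open set. A smooth immersion $X:\Omega\to\mathbb R^4$ is *conformal Lagrangian* if $|X_x|=|X_y|$, $\langle X_x,X_y\rangle=0$ and $\omega(X_x,X_y)=0$. It is *Hamiltonian stationary* if the first variation of its area vanishes along every smooth compactly supported vector field $V$ along $X$ for which there is $h\in C_c^\infty(\Omega,\mathbb R)$ with $\omega(V,dX)=dh$. A *lifted conformal Lagrangian immersion* (LCLI) based at $z_0\in\Omega$ is a smooth map $U=(F,X):\Omega\to\mathcal G$ such that $U(z_0)=1$ and the translation component of its Maurer–Cartan form $U^{-1}dU$ is $$F^{-1}dX=e^{f}K(\epsilon_1\,dx+\epsilon_3\,dy)$$ for some smooth $f:\Omega\to\mathbb R$ and $K:\Omega\to\mathcal G_0$. It is called Hamiltonian stationary if $X$ is. For a smooth $\mathfrak g$-valued 1-form $\alpha$ on $\Omega$ put $\alpha_k=[\alpha]_k$, $\alpha_k'=\alpha_k(\partial_z)\,dz$, $\alpha_k''=\alpha_k(\partial_{\bar z})\,d\bar z$, and for $\lambda\in\mathbb C^*$ $$\alpha_\lambda=\lambda^{-2}\alpha_2'+\lambda^{-1}\alpha_{-1}'+\alpha_0+\lambda\,\alpha_1''+\lambda^2\alpha_2''.$$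 **Corollary.** Let $\alpha$ be the Maurer–Cartan form $U^{-1}dU$ of a Hamiltonian stationary LCLI $U$ on $\Omega$ (based at some point of $\Omega$), and let $z_0\in\Omega$. Then for every $\lambda\in S^1$ there is an LCLI $U_\lambda$ based at $z_0$ with $$dU_\lambda=U_\lambda\,\alpha_\lambda,\qquad U_\lambda(z_0)=1,$$ and it is the only smooth map $\Omega\to\mathcal G$ with these two properties. Moreover, writing $U_\lambda=(F_\lambda,X_\lambda)$, the map $X_\lambda:\Omega\to\mathbb R^4$ is, for every $\lambda\in S^1$, a Hamiltonian stationary conformal Lagrangian immersion. -/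

import Mathlib

open scoped ContDiff Matrix
open MeasureTheory

noncomputable section

namespace HSLag

/-- Coordinate vectors of the Euclidean 4-space; lengths and angles are measured with the
dot product `⬝ᵥ`, never with the supremum norm. -/
abbrev V4 : Type := Fin 4 → ℝ

/-- Real `4 × 4` matrices. -/
abbrev M4 : Type := Matrix (Fin 4) (Fin 4) ℝ

/-- `5 × 5` matrices, in blocks `4 + 1`: the pair `(G, T)` is the matrix with blocks
`G, T, 0, 1`. -/
abbrev M5 (R : Type) : Type := Matrix (Fin 4 ⊕ Unit) (Fin 4 ⊕ Unit) R

/-- The complex structure (left multiplication by the quaternion `i`). -/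
def Li : M4 := !![0, -1, 0, 0; 1, 0, 0, 0; 0, 0, 0, -1; 0, 0, 1, 0]

/-- Left multiplication by the quaternion `j`. -/
def Lj : M4 := !![0, 0, -1, 0; 0, 0, 0, 1; 1, 0, 0, 0; 0, -1, 0, 0]

/-- Right multiplication by the quaternion `i`. -/
def Ri : M4 := !![0, -1, 0, 0; 1, 0, 0, 0; 0, 0, 0, 1; 0, 0, -1, 0]

/-- Right multiplication by the quaternion `j`. -/
def Rj : M4 := !![0, 0, -1, 0; 0, 0, 0, -1; 1, 0, 0, 0; 0, 1, 0, 0]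

/-- Right multiplication by the quaternion `k`. -/
def Rk : M4 := !![0, 0, 0, -1; 0, 0, 1, 0; 0, -1, 0, 0; 1, 0, 0, 0]

/-- The symplectic form `ω(x, y) = ⟨J x, y⟩`, that is `dx¹ ∧ dx² + dx³ ∧ dx⁴`. -/
def omega (x y : V4) : ℝ := (Li *ᵥ x) ⬝ᵥ y

/-- First vector of the reference frame. -/
def eps1 : V4 := ![1, 0, 0, 0]

/-- Third vector of the reference frame. -/
def eps3 : V4 := ![0, 0, 1, 0]

/-- The affine map `x ↦ G x + T` as a `5 × 5` matrix. -/
def affine (G : M4) (T : V4) : M5 ℝ :=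
  Matrix.fromBlocks G (Matrix.of fun i _ => T i) 0 1

/-- The translation component (last column) of a `5 × 5` matrix. -/
def transl (A : M5 ℝ) : V4 := fun i => A (Sum.inl i) (Sum.inr ())

/-- The group of affine transformations of the Euclidean 4-space that preserve the scalar
product and the symplectic form. -/
def groupG : Set (M5 ℝ) :=
  {A | ∃ (G : M4) (T : V4), A = affine G T ∧
    (∀ x y, (G *ᵥ x) ⬝ᵥ (G *ᵥ y) = x ⬝ᵥ y) ∧
    (∀ x y, omega (G *ᵥ x) (G *ᵥ y) = omega x y)}

/-- The subgroup `{R_{q̄} | q a unit quaternion}` of linear transformations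
(it corresponds to `SU(2)`). -/
def groupG0 : Set M4 :=
  {K | ∃ q : Fin 4 → ℝ, q 0 ^ 2 + q 1 ^ 2 + q 2 ^ 2 + q 3 ^ 2 = 1 ∧
    K = q 0 • (1 : M4) - q 1 • Ri - q 2 • Rj - q 3 • Rk}

/-- The Lie algebra of `groupG`:
all pairs `(a L_i + b₁ R_i + b₂ R_j + b₃ R_k, t)`. -/
def lieG : Set (M5 ℝ) :=
  {A | ∃ (a b₁ b₂ b₃ : ℝ) (t : V4),
    A = Matrix.fromBlocks (a • Li + b₁ • Ri + b₂ • Rj + b₃ • Rk)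
      (Matrix.of fun i _ => t i) 0 0}

/-- Smoothness on `Ω` of a matrix-valued map, entry by entry. -/
def SmoothOn {n : Type} (Ω : Set ℂ) (A : ℂ → Matrix n n ℝ) : Prop :=
  ∀ i j, ContDiffOn ℝ ∞ (fun z => A z i j) Ω

/-- The differential of a matrix-valued map at `z`, on the tangent vector `v`,
entry by entry. -/
def matD {n : Type} (A : ℂ → Matrix n n ℝ) (z v : ℂ) : Matrix n n ℝ :=
  Matrix.of fun i j => fderiv ℝ (fun w => A w i j) z v

/-- The Maurer-Cartan form `U⁻¹ dU`, at the point `z` and the tangent vector `v`. -/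
def maurerCartan (U : ℂ → M5 ℝ) (z v : ℂ) : M5 ℝ := (U z)⁻¹ * matD U z v

/-- Entrywise inclusion of real matrices in complex ones. -/
def toC (A : M5 ℝ) : M5 ℂ := A.map Complex.ofReal

/-- The automorphism `τ`: conjugation by `(-L_j, 0)`, on complex matrices
(`L_j² = -1`, so the inverse of `(-L_j, 0)` is `(L_j, 0)`). -/
def tau (A : M5 ℂ) : M5 ℂ := toC (affine (-Lj) 0) * A * toC (affine Lj 0)

/-- The projection onto the eigenspace of `τ` for the eigenvalue `i ^ k`, along the other
eigenspaces; since `τ⁴ = 1` it is the average `(1/4) ∑_{m < 4} i^{-km} τ^m`. -/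
def proj (k : ℤ) (A : M5 ℂ) : M5 ℂ :=
  (1 / 4 : ℂ) • ∑ m ∈ Finset.range 4, Complex.I ^ (-(k * (m : ℤ))) • tau^[m] A

/-- The value on `∂/∂z = (∂/∂x - i ∂/∂y)/2` of the complexified 1-form `a` (at a point). -/
def onDz (a : ℂ →ₗ[ℝ] M5 ℝ) : M5 ℂ :=
  (1 / 2 : ℂ) • (toC (a 1) - Complex.I • toC (a Complex.I))

/-- The value on `∂/∂z̄ = (∂/∂x + i ∂/∂y)/2` of the complexified 1-form `a` (at a point). -/
def onDzbar (a : ℂ →ₗ[ℝ] M5 ℝ) : M5 ℂ :=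
  (1 / 2 : ℂ) • (toC (a 1) + Complex.I • toC (a Complex.I))

/-- The extended form
`α_λ = λ⁻² α₂' + λ⁻¹ α₋₁' + α₀ + λ α₁'' + λ² α₂''` (at a point), on the tangent vector `v`;
`dz` and `dz̄` take the values `v` and `conj v` there. -/
def extended (lam : ℂ) (a : ℂ →ₗ[ℝ] M5 ℝ) (v : ℂ) : M5 ℂ :=
  (lam ^ (-2 : ℤ) * v) • proj 2 (onDz a)
    + (lam ^ (-1 : ℤ) * v) • proj (-1) (onDz a)
    + proj 0 (toC (a v))
    + (lam * starRingEnd ℂ v) • proj 1 (onDzbar a)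
    + (lam ^ (2 : ℤ) * starRingEnd ℂ v) • proj 2 (onDzbar a)

/-- `U` is a lifted conformal Lagrangian immersion of `Ω` with base point `z₀`. -/
structure IsLCLI (Ω : Set ℂ) (z₀ : ℂ) (U : ℂ → M5 ℝ) : Prop where
  smooth : SmoothOn Ω U
  mem : ∀ z ∈ Ω, U z ∈ groupG
  base : U z₀ = 1
  translation : ∃ (f : ℂ → ℝ) (K : ℂ → M4),
    ContDiffOn ℝ ∞ f Ω ∧ SmoothOn Ω K ∧ (∀ z ∈ Ω, K z ∈ groupG0) ∧
    ∀ z ∈ Ω, ∀ v : ℂ, transl (maurerCartan U z v)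
      = Real.exp (f z) • (v.re • (K z *ᵥ eps1) + v.im • (K z *ᵥ eps3))

/-- The partial derivative `∂X/∂x`. -/
def dX (X : ℂ → V4) (z : ℂ) : V4 := fderiv ℝ X z 1

/-- The partial derivative `∂X/∂y`. -/
def dY (X : ℂ → V4) (z : ℂ) : V4 := fderiv ℝ X z Complex.I

/-- `X` is a smooth conformal Lagrangian immersion of `Ω`. -/
structure IsConformalLagrangianImmersion (Ω : Set ℂ) (X : ℂ → V4) : Prop where
  smooth : ContDiffOn ℝ ∞ X Ω
  immersion : ∀ z ∈ Ω, 0 < dX X z ⬝ᵥ dX X z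
  conformal : ∀ z ∈ Ω, dX X z ⬝ᵥ dX X z = dY X z ⬝ᵥ dY X z
  orthogonal : ∀ z ∈ Ω, dX X z ⬝ᵥ dY X z = 0
  lagrangian : ∀ z ∈ Ω, omega (dX X z) (dY X z) = 0

/-- The density, with respect to `dx dy`, of the area of the metric induced by `X`. -/
def areaDensity (X : ℂ → V4) (z : ℂ) : ℝ :=
  Real.sqrt ((dX X z ⬝ᵥ dX X z) * (dY X z ⬝ᵥ dY X z) - (dX X z ⬝ᵥ dY X z) ^ 2)

/-- `X` is Hamiltonian stationary on `Ω`: the first variation of the area vanishes along every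
compactly supported Hamiltonian vector field `V` along `X`, that is, every smooth compactly
supported `V` for which the pulled back 1-form `ω(V, dX)` is the differential of a smooth
compactly supported function `h` on `Ω`
(`V = -J ∇h` means `ω(V, ·) = dh`). -/
def IsHamiltonianStationary (Ω : Set ℂ) (X : ℂ → V4) : Prop :=
  ∀ (h : ℂ → ℝ) (V : ℂ → V4),
    ContDiff ℝ ∞ h → HasCompactSupport h → tsupport h ⊆ Ω →
    ContDiff ℝ ∞ V → HasCompactSupport V → tsupport V ⊆ Ω →
    (∀ z ∈ Ω, ∀ v : ℂ, omega (V z) (fderiv ℝ X z v) = fderiv ℝ h z v) →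
    HasDerivAt
      (fun t : ℝ => ∫ z in tsupport V, areaDensity (fun w => X w + t • V w) z) 0 0

end HSLag

end

/-! The whole argument rests on the `L_i` component `a` of the Maurer–Cartan form of a lift. Since
`L_i` commutes with every `R_q`, the structure equation gives `da = 0` (`IsFrame.closed`). Its
translation part gives `ΔX = 2 J (a_x X_x + a_y X_y)` (`IsFrame.laplacian`). In conformal
coordinates the area has the same first variation as the Dirichlet energy. Integrating by parts
against a field `V` with `ω(V, dX) = dh` therefore leaves `-2 ∫ h div a`, so `X` is Hamiltonian
stationary exactly when `a` is coclosed (`IsFrame.isHamiltonianStationary_iff`).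

The automorphism `τ` is `-1` on `L_i`, `1` on the `R_q`, and has eigenvalues `±i` on translations.
For `λ = c + s i` on the unit circle this makes `α_λ` real: its `L_i` part is `a` evaluated at `λ⁻²
v`, its `R_q` part is unchanged, and its translation part is evaluated at `λ⁻¹ v` (`extended_eq`).

The form is then integrated by two scalar or vector primitives, without solving a matrix equation.
The difference `a(λ⁻² ·) - a` is closed because `a` is closed and coclosed; let `φ` be a primitive.
As `L_i` commutes with `F`, the linear part is `F_λ = exp(φ L_i) F(z₀)⁻¹ F`. The formula for `ΔX`
then makes the form that should be `dX_λ` closed, and `X_λ` is its primitive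
(`IsFrame.exists_associated`). The rotated form `a(λ⁻² ·)` is again coclosed, so `X_λ` is
Hamiltonian stationary. Primitives exist globally because the covering of `Ω` by local primitives
has a section. -/

namespace HSLag

/-! ### Primitives of closed 1-forms on simply connected open sets -/

/-- A copy of a type, with the discrete topology. -/
def DiscreteCopy (G : Type*) : Type _ := G

instance (G : Type*) : TopologicalSpace (DiscreteCopy G) := ⊥

instance (G : Type*) : DiscreteTopology (DiscreteCopy G) := ⟨rfl⟩

section Primitive

variable {E G : Type*} [NormedAddCommGroup E] [NormedSpace ℝ E] [NormedAddCommGroup G]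
  [NormedSpace ℝ G] {Ω : Set E} {η : E → E →L[ℝ] G}

/-- The difference of two primitives has derivative zero, and an intersection of balls is convex.
This makes the transition maps of the covering below locally constant. -/
theorem sub_eq_sub_of_hasFDerivAt_ball_inter {x y z w : E} {r s : ℝ} {f g : E → G}
    (hf : ∀ p ∈ Metric.ball x r, HasFDerivAt f (η p) p)
    (hg : ∀ p ∈ Metric.ball y s, HasFDerivAt g (η p) p)
    (hz : z ∈ Metric.ball x r ∩ Metric.ball y s) (hw : w ∈ Metric.ball x r ∩ Metric.ball y s) :
    f z - g z = f w - g w := by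
  have hc : Convex ℝ (Metric.ball x r ∩ Metric.ball y s) :=
    (convex_ball x r).inter (convex_ball y s)
  have hd : ∀ p ∈ Metric.ball x r ∩ Metric.ball y s,
      HasFDerivWithinAt (fun p => f p - g p) (0 : E →L[ℝ] G)
        (Metric.ball x r ∩ Metric.ball y s) p := fun p hp => by
    have := ((hf p hp.1).sub (hg p hp.2)).hasFDerivWithinAt
      (s := Metric.ball x r ∩ Metric.ball y s)
    rwa [sub_self] at this
  have := hc.norm_image_sub_le_of_norm_hasFDerivWithin_le (C := 0) hd (by simp) hw hz
  rw [zero_mul, norm_le_zero_iff, sub_eq_zero] at this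
  exact this

/-- The covering of `Ω` whose sheets are the local primitives of a 1-form. -/
def primitiveCore (r : Ω → ℝ) (hr : ∀ i, 0 < r i) (g : Ω → E → G)
    (hg : ∀ i : Ω, ∀ p ∈ Metric.ball (i : E) (r i), HasFDerivAt (g i) (η p) p) :
    FiberBundleCore Ω Ω (DiscreteCopy G) where
  baseSet i := {x | (x : E) ∈ Metric.ball (i : E) (r i)}
  isOpen_baseSet i := Metric.isOpen_ball.preimage continuous_subtype_val
  indexAt x := x
  mem_baseSet_at x := Metric.mem_ball_self (hr x)
  coordChange i j x v := (show G from v) + (g i x - g j x)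
  coordChange_self i x _ v := by
    change (show G from v) + (g i x - g i x) = v
    rw [sub_self, add_zero]
  continuousOn_coordChange i j := by
    rintro ⟨x, v⟩ ⟨hx, -⟩
    let φ : Ω × DiscreteCopy G → DiscreteCopy G := fun p =>
      ((show G from p.2) + (g i p.1 - g j p.1) : G)
    -- With a discrete fibre, continuity of the transition map amounts to its being locally
    -- constant.
    have hev : ∀ᶠ p : Ω × DiscreteCopy G in
        nhdsWithin (x, v) (({x : Ω | (x : E) ∈ Metric.ball (i : E) (r i)} ∩
          {x : Ω | (x : E) ∈ Metric.ball (j : E) (r j)}) ×ˢ Set.univ), φ (x, v) = φ p := by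
      have h2 : ∀ᶠ p : Ω × DiscreteCopy G in nhds (x, v), p.2 = v :=
        (continuous_snd.tendsto (x, v)).eventually (p := fun w => w = v) (by simp [nhds_discrete])
      filter_upwards [self_mem_nhdsWithin, nhdsWithin_le_nhds h2] with p hp hp2
      change (show G from v) + (g i x - g j x) = (show G from p.2) + (g i p.1 - g j p.1)
      rw [hp2, sub_eq_sub_of_hasFDerivAt_ball_inter (hg i) (hg j) hp.1 hx]
    exact (tendsto_const_nhds (x := φ (x, v))).congr' hev
  coordChange_comp i j k x _ v := by
    change (show G from v) + (g i x - g j x) + (g j x - g k x) = (show G from v) + (g i x - g k x)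
    abel

/-- On a simply connected open set, a 1-form that has local primitives has a primitive. -/
theorem exists_primitive_of_locally (hΩ : IsOpen Ω) (hsc : IsSimplyConnected Ω)
    (hloc : ∀ x ∈ Ω, ∃ r > 0, ∃ g : E → G, ∀ p ∈ Metric.ball x r, HasFDerivAt g (η p) p) :
    ∃ g : E → G, ∀ x ∈ Ω, HasFDerivAt g (η x) x := by
  classical
  have hloc' : ∀ x : Ω, ∃ r > 0, ∃ g : E → G,
      ∀ p ∈ Metric.ball (x : E) r, HasFDerivAt g (η p) p := fun x => hloc x x.2
  choose r hr g hg using hloc'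
  have := hsc.simplyConnectedSpace
  have := hΩ.locallyPathConnectedSpace
  obtain ⟨x₀, hx₀⟩ := hsc.nonempty
  let Z := primitiveCore r hr g hg
  have hcov : IsCoveringMap Z.proj :=
    IsFiberBundle.isCoveringMap fun x => ⟨Z.localTriv x, Z.mem_baseSet_at x⟩
  -- Simple connectedness enters here: the identity of `Ω` lifts to a global section `σ` of the
  -- covering. The initial value `0` is arbitrary.
  obtain ⟨σ, ⟨-, hσ⟩, -⟩ := hcov.existsUnique_continuousMap_lifts (ContinuousMap.id Ω) ⟨x₀, hx₀⟩
    ⟨⟨x₀, hx₀⟩, (0 : G)⟩ rfl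
  have hσ' : ∀ x, (σ x).1 = x := fun x => congrFun hσ x
  -- The fibre coordinate of `σ` at `p` is read in the chart indexed by `p` itself. Read in the
  -- fixed chart `i`, it is locally constant, so near `x` this function is `g i` plus a constant.
  refine ⟨fun p => if hp : p ∈ Ω then (show G from (σ ⟨p, hp⟩).2) + g ⟨p, hp⟩ p else 0,
    fun x hx => ?_⟩
  let i : Ω := ⟨x, hx⟩
  have hc : ContinuousAt (fun y : Ω => ((Z.localTriv i) (σ y)).2) i := by
    refine continuous_snd.continuousAt.comp (ContinuousAt.comp ?_ σ.continuous.continuousAt)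
    refine (Z.localTriv i).continuousAt ?_
    rw [(Z.localTriv i).mem_source]
    change (σ i).1 ∈ Z.baseSet i
    rw [hσ']
    exact Z.mem_baseSet_at i
  have hconst : ∀ᶠ y : Ω in nhds i, ((Z.localTriv i) (σ y)).2 = ((Z.localTriv i) (σ i)).2 := by
    have := hc.eventually (p := fun v => v = ((Z.localTriv i) (σ i)).2) (by simp [nhds_discrete])
    exact this
  have hconst' : ∀ᶠ p in nhds x, ∀ hp : p ∈ Ω,
      ((Z.localTriv i) (σ ⟨p, hp⟩)).2 = ((Z.localTriv i) (σ i)).2 := by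
    rw [nhds_subtype_eq_comap, Filter.eventually_comap] at hconst
    exact hconst.mono fun p h hp => h ⟨p, hp⟩ rfl
  have hcoord : ∀ y : Ω, (((Z.localTriv i) (σ y)).2 : G)
      = (show G from (σ y).2) + (g y y - g i y) := fun y => by
    rw [FiberBundleCore.localTriv_apply]
    change (show G from (σ y).2) + (g (σ y).1 (σ y).1 - g i (σ y).1) = _
    rw [hσ']
  have hd := (hg i x (Metric.mem_ball_self (hr i))).const_add
    (show G from ((Z.localTriv i) (σ i)).2)
  refine hd.congr_of_eventuallyEq ?_
  filter_upwards [hconst', hΩ.mem_nhds hx] with p hp hpΩ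
  rw [dif_pos hpΩ]
  have h1 := hp hpΩ
  change _ = (show G from ((Z.localTriv i) (σ i)).2) + g i p
  rw [← h1]
  have h2 := congrArg (· + g i p) (hcoord ⟨p, hpΩ⟩)
  refine Eq.trans ?_ h2.symm
  change _ = (show G from (σ ⟨p, hpΩ⟩).2) + (g ⟨p, hpΩ⟩ p - g i p) + g i p
  abel

/-- A closed 1-form on a simply connected open set has a primitive. -/
theorem exists_primitive_of_closed [CompleteSpace G] (hΩ : IsOpen Ω) (hsc : IsSimplyConnected Ω)
    (hη : DifferentiableOn ℝ η Ω)
    (hcl : ∀ a ∈ Ω, ∀ x y, fderiv ℝ η a x y = fderiv ℝ η a y x) :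
    ∃ g : E → G, ∀ x ∈ Ω, HasFDerivAt g (η x) x := by
  refine exists_primitive_of_locally hΩ hsc fun x hx => ?_
  obtain ⟨r, hr, hb⟩ := Metric.isOpen_iff.1 hΩ x hx
  exact ⟨r, hr, (convex_ball x r).exists_forall_hasFDerivAt_of_fderiv_symmetric
    Metric.isOpen_ball (hη.mono hb) fun a ha => hcl a (hb ha)⟩

end Primitive

/-! ### Quaternionic matrix algebra -/

theorem Li_mul_Li : Li * Li = -1 := by
  ext i j; fin_cases i <;> fin_cases j <;> simp [Li, Matrix.mul_apply, Fin.sum_univ_four]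

theorem Lj_mul_Lj : Lj * Lj = -1 := by
  ext i j; fin_cases i <;> fin_cases j <;> simp [Lj, Matrix.mul_apply, Fin.sum_univ_four]

theorem Li_transpose : Liᵀ = -Li := by
  ext i j; fin_cases i <;> fin_cases j <;> simp [Li]

/-- The linear part of an element of the Lie algebra. -/
noncomputable def linPart (a b₁ b₂ b₃ : ℝ) : M4 := a • Li + b₁ • Ri + b₂ • Rj + b₃ • Rk

theorem linPart_apply (a b₁ b₂ b₃ : ℝ) : linPart a b₁ b₂ b₃ =
    !![0, -a - b₁, -b₂, -b₃; a + b₁, 0, b₃, -b₂; b₂, -b₃, 0, -a + b₁; b₃, b₂, a - b₁, 0] := by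
  ext i j; fin_cases i <;> fin_cases j <;> simp [linPart, Li, Ri, Rj, Rk] <;> ring

theorem linPart_transpose (a b₁ b₂ b₃ : ℝ) : (linPart a b₁ b₂ b₃)ᵀ = -linPart a b₁ b₂ b₃ := by
  rw [linPart_apply]
  ext i j; fin_cases i <;> fin_cases j <;> simp <;> ring

theorem linPart_add_smul_Li (a b₁ b₂ b₃ c : ℝ) :
    linPart (c + a) b₁ b₂ b₃ = c • Li + linPart a b₁ b₂ b₃ := by
  simp only [linPart, add_smul, add_assoc]

theorem Lj_mulVec (u : V4) : Lj *ᵥ u = ![-u 2, u 3, u 0, -u 1] := by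
  ext i; fin_cases i <;> simp [Lj, Matrix.mulVec, dotProduct, Fin.sum_univ_four]

theorem dotProduct_Li_mulVec (x y : V4) : (Li *ᵥ x) ⬝ᵥ y = -(x ⬝ᵥ (Li *ᵥ y)) := by
  simp [Li, Matrix.mulVec, dotProduct, Fin.sum_univ_four]; ring

theorem omega_self_Lj (u : V4) : omega u (Lj *ᵥ u) = 0 := by
  simp [omega, Li, Lj, Matrix.mulVec, dotProduct, Fin.sum_univ_four]; ring

theorem dotProduct_Lj_mulVec_self (u : V4) : u ⬝ᵥ (Lj *ᵥ u) = 0 := by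
  simp [Lj, Matrix.mulVec, dotProduct, Fin.sum_univ_four]; ring

theorem dotProduct_Lj_mulVec_Lj_mulVec (u : V4) : (Lj *ᵥ u) ⬝ᵥ (Lj *ᵥ u) = u ⬝ᵥ u := by
  simp [Lj, Matrix.mulVec, dotProduct, Fin.sum_univ_four]; ring

/-- The element of `groupG0` attached to the quaternion `q`. -/
noncomputable def rightMul (q : V4) : M4 := q 0 • (1 : M4) - q 1 • Ri - q 2 • Rj - q 3 • Rk

theorem rightMul_apply (q : V4) : rightMul q =
    !![q 0, q 1, q 2, q 3; -q 1, q 0, -q 3, q 2; -q 2, q 3, q 0, -q 1; -q 3, -q 2, q 1, q 0] := by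
  ext i j; fin_cases i <;> fin_cases j <;> simp [rightMul, Ri, Rj, Rk]

/-- Left and right multiplications commute, and `L_j ε₁ = ε₃`. Hence the translation part of a lift
is `u dx + L_j u dy`, and `K` can be replaced by the single vector `u = e^f K ε₁`. -/
theorem rightMul_mulVec_eps3 (q : V4) : rightMul q *ᵥ eps3 = Lj *ᵥ (rightMul q *ᵥ eps1) := by
  rw [rightMul_apply]
  ext i; fin_cases i <;>
    simp [eps1, eps3, Lj, Matrix.mulVec, dotProduct, Fin.sum_univ_four]

theorem rightMul_mulVec_eps1_dotProduct (q : V4) :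
    (rightMul q *ᵥ eps1) ⬝ᵥ (rightMul q *ᵥ eps1) = q 0 ^ 2 + q 1 ^ 2 + q 2 ^ 2 + q 3 ^ 2 := by
  rw [rightMul_apply]
  simp [eps1, Matrix.mulVec, dotProduct, Fin.sum_univ_four]; ring

theorem smul_sub_smul_mul_Rj_mem_groupG0 {K : M4} (hK : K ∈ groupG0) {c s : ℝ}
    (hcs : c ^ 2 + s ^ 2 = 1) : c • K - s • (K * Rj) ∈ groupG0 := by
  obtain ⟨q, hq, rfl⟩ := hK
  -- The components of `q (c + s j)`: the matrix `c - s R_j` is right multiplication by the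
  -- conjugate of `c + s j`.
  refine ⟨![c * q 0 - s * q 2, c * q 1 - s * q 3, c * q 2 + s * q 0, c * q 3 + s * q 1], ?_, ?_⟩
  · simp
    linear_combination (c ^ 2 + s ^ 2) * hq + hcs
  · change c • rightMul q - s • (rightMul q * Rj) = rightMul _
    rw [rightMul_apply, rightMul_apply]
    ext i j; fin_cases i <;> fin_cases j <;>
      simp [Rj] <;> ring

/-- `R_j` and `L_j` agree on `ε₁`, and `K` commutes with `L_j`. So the rotation `c - s L_j` of `K
ε₁` is absorbed into an element of `groupG0`. -/
theorem smul_sub_smul_mul_Rj_mulVec_eps1 {K : M4} (hK : K ∈ groupG0) (c s : ℝ) :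
    (c • K - s • (K * Rj)) *ᵥ eps1 = c • (K *ᵥ eps1) - s • (Lj *ᵥ (K *ᵥ eps1)) := by
  obtain ⟨q, -, rfl⟩ := hK
  change (c • rightMul q - s • (rightMul q * Rj)) *ᵥ eps1
    = c • (rightMul q *ᵥ eps1) - s • (Lj *ᵥ (rightMul q *ᵥ eps1))
  rw [rightMul_apply]
  ext i; fin_cases i <;>
    simp [Rj, Lj, eps1, Matrix.mulVec, dotProduct, Fin.sum_univ_four]

/-! ### The extended Maurer-Cartan form -/

/-- The element `(a L_i + b₁ R_i + b₂ R_j + b₃ R_k, t)` of the Lie algebra. -/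
noncomputable def lieElt (a b₁ b₂ b₃ : ℝ) (t : V4) : M5 ℝ :=
  Matrix.fromBlocks (linPart a b₁ b₂ b₃) (Matrix.of fun i _ => t i) 0 0

/-- The elements of the complexified Lie algebra. -/
noncomputable def lieEltC (a b₁ b₂ b₃ : ℂ) (t : Fin 4 → ℂ) : M5 ℂ :=
  Matrix.fromBlocks
    !![0, -a - b₁, -b₂, -b₃; a + b₁, 0, b₃, -b₂; b₂, -b₃, 0, -a + b₁; b₃, b₂, a - b₁, 0]
    (Matrix.of fun i _ => t i) 0 0

theorem toC_lieElt (a b₁ b₂ b₃ : ℝ) (t : V4) :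
    toC (lieElt a b₁ b₂ b₃ t) = lieEltC a b₁ b₂ b₃ fun i => t i := by
  rw [lieElt, linPart_apply]
  ext (i | i) (j | j)
  · fin_cases i <;> fin_cases j <;> simp [toC, lieEltC]
  all_goals simp [toC, lieEltC]

theorem lieEltC_add (a b₁ b₂ b₃ : ℂ) (t : Fin 4 → ℂ) (a' b₁' b₂' b₃' : ℂ) (t' : Fin 4 → ℂ) :
    lieEltC a b₁ b₂ b₃ t + lieEltC a' b₁' b₂' b₃' t' =
      lieEltC (a + a') (b₁ + b₁') (b₂ + b₂') (b₃ + b₃') (t + t') := by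
  ext (i | i) (j | j)
  · fin_cases i <;> fin_cases j <;> simp [lieEltC] <;> ring
  all_goals simp [lieEltC]

theorem smul_lieEltC (c a b₁ b₂ b₃ : ℂ) (t : Fin 4 → ℂ) :
    c • lieEltC a b₁ b₂ b₃ t = lieEltC (c * a) (c * b₁) (c * b₂) (c * b₃) (c • t) := by
  ext (i | i) (j | j)
  · fin_cases i <;> fin_cases j <;> simp [lieEltC] <;> ring
  all_goals simp [lieEltC]

/-- `L_i` anticommutes with `L_j`, while the right multiplications commute with it. The new
translation vector is `-L_j t`. -/
theorem tau_lieEltC (a b₁ b₂ b₃ : ℂ) (t : Fin 4 → ℂ) :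
    tau (lieEltC a b₁ b₂ b₃ t) = lieEltC (-a) b₁ b₂ b₃ ![t 2, -t 3, -t 0, t 1] := by
  have h : ∀ (G : M4), toC (affine G 0) =
      Matrix.fromBlocks (G.map Complex.ofReal) 0 0 1 := fun G => by
    ext (i | i) (j | j) <;> simp [toC, affine]
  rw [tau, h, h, lieEltC, lieEltC, Matrix.fromBlocks_multiply, Matrix.fromBlocks_multiply]
  congr 1
  · ext i j
    fin_cases i <;> fin_cases j <;> simp [Lj, Matrix.mul_apply, Fin.sum_univ_four] <;> ring
  · ext i j
    fin_cases i <;> simp [Lj, Matrix.mul_apply, Fin.sum_univ_four]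
  · simp
  · simp

/-- The coefficients are the geometric sums of `(p τ)^m` for `m < 4`, where `τ` is `-1` on `L_i`,
`1` on the right multiplications, and satisfies `τ² = -1` on translations. -/
theorem proj_lieEltC (k : ℤ) (a b₁ b₂ b₃ : ℂ) (t : Fin 4 → ℂ) {p : ℂ}
    (hp : Complex.I ^ (-k) = p) :
    proj k (lieEltC a b₁ b₂ b₃ t) =
      lieEltC ((1 - p + p ^ 2 - p ^ 3) / 4 * a) ((1 + p + p ^ 2 + p ^ 3) / 4 * b₁)
        ((1 + p + p ^ 2 + p ^ 3) / 4 * b₂) ((1 + p + p ^ 2 + p ^ 3) / 4 * b₃)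
        (((1 - p ^ 2) / 4) • (t + p • ![t 2, -t 3, -t 0, t 1])) := by
  have hm : ∀ m : ℕ, Complex.I ^ (-(k * (m : ℤ))) = p ^ m := fun m => by
    rw [← hp, ← zpow_natCast, ← zpow_mul, neg_mul]
  simp only [proj, hm, Finset.sum_range_succ, Finset.sum_range_zero, Function.iterate_succ,
    Function.iterate_zero, Function.comp, id, tau_lieEltC, smul_lieEltC, lieEltC_add, zero_add]
  congr 1
  · ring
  · ring
  · ring
  · ring
  · ext i; fin_cases i <;>
      simp [-Matrix.add_cons, -Matrix.cons_add, -Matrix.smul_cons] <;> ring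

theorem smul_sub_add_conj_smul (w : ℂ) (x y : ℝ) :
    w * ((1 / 2) * (x - Complex.I * y)) + starRingEnd ℂ w * ((1 / 2) * (x + Complex.I * y))
      = ((w.re * x + w.im * y : ℝ) : ℂ) := by
  apply Complex.ext <;> simp <;> ring

/-- The `dz` part `(u - i L_j u)/2` of `u dx + L_j u dy` is an eigenvector of `τ` for `-i`, and its
conjugate is one for `i`. So `α₋₁'` and `α₁''` carry the whole translation part. For `|λ| = 1` the
terms of `α_λ` pair into complex conjugates, and each real component is evaluated at `v` multiplied
by a power of `λ⁻¹`. -/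
theorem extended_eq {η : ℂ →ₗ[ℝ] M5 ℝ} {a b₁ b₂ b₃ : ℂ → ℝ} {u : V4}
    (hη : ∀ v, η v = lieElt (a v) (b₁ v) (b₂ v) (b₃ v) (v.re • u + v.im • (Lj *ᵥ u)))
    {l w₁ w₂ : ℂ} (v : ℂ) (h₁ : w₁ = l⁻¹ * v) (h₂ : w₂ = l⁻¹ * w₁)
    (hl : starRingEnd ℂ l = l⁻¹) :
    extended l η v = toC (lieElt (w₂.re * a 1 + w₂.im * a Complex.I) (b₁ v) (b₂ v) (b₃ v)
      (w₁.re • u + w₁.im • (Lj *ᵥ u))) := by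
  have hc : starRingEnd ℂ l⁻¹ = l := by rw [← hl, Complex.conj_conj]
  have e1 : l ^ (-1 : ℤ) * v = w₁ := by rw [h₁, zpow_neg_one]
  have e2 : l ^ (-2 : ℤ) * v = w₂ := by
    rw [h₂, h₁, zpow_neg, ← mul_assoc, zpow_two, mul_inv]
  have e3 : l * starRingEnd ℂ v = starRingEnd ℂ w₁ := by rw [h₁, map_mul, hc]
  have e4 : l ^ (2 : ℤ) * starRingEnd ℂ v = starRingEnd ℂ w₂ := by
    rw [h₂, h₁, map_mul, map_mul, hc, ← mul_assoc, zpow_two]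
  have hI1 : Complex.I ^ (-(-1) : ℤ) = Complex.I := by simp
  have hI2 : Complex.I ^ (-1 : ℤ) = -Complex.I := by simp
  have hI3 : Complex.I ^ (-2 : ℤ) = -1 := by
    rw [zpow_neg]; norm_cast; simp
  have hI4 : Complex.I ^ (-0 : ℤ) = 1 := by simp
  have h2 : Complex.I ^ 2 = -1 := Complex.I_sq
  have h3 : Complex.I ^ 3 = -Complex.I := by rw [pow_succ, h2, neg_one_mul]
  have hs : ∀ x y : M5 ℂ, x - Complex.I • y = x + (-Complex.I) • y := fun x y => by
    rw [neg_smul, sub_eq_add_neg]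
  have hz : onDz η = lieEltC ((1 / 2) * (a 1 - Complex.I * a Complex.I))
      ((1 / 2) * (b₁ 1 - Complex.I * b₁ Complex.I)) ((1 / 2) * (b₂ 1 - Complex.I * b₂ Complex.I))
      ((1 / 2) * (b₃ 1 - Complex.I * b₃ Complex.I))
      (fun i => (1 / 2) * (u i - Complex.I * (Lj *ᵥ u) i)) := by
    rw [onDz, hη, hη, toC_lieElt, toC_lieElt, hs, smul_lieEltC, lieEltC_add, smul_lieEltC]
    congr 1
    · ring
    · ring
    · ring
    · ring
    · ext i; simp; ring
  have hzbar : onDzbar η = lieEltC ((1 / 2) * (a 1 + Complex.I * a Complex.I))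
      ((1 / 2) * (b₁ 1 + Complex.I * b₁ Complex.I)) ((1 / 2) * (b₂ 1 + Complex.I * b₂ Complex.I))
      ((1 / 2) * (b₃ 1 + Complex.I * b₃ Complex.I))
      (fun i => (1 / 2) * (u i + Complex.I * (Lj *ᵥ u) i)) := by
    rw [onDzbar, hη, hη, toC_lieElt, toC_lieElt, smul_lieEltC, lieEltC_add, smul_lieEltC]
    congr 1
    ext i; simp
  rw [extended, e1, e2, e3, e4, hz, hzbar, hη v, toC_lieElt, toC_lieElt,
    proj_lieEltC 2 _ _ _ _ _ hI3, proj_lieEltC 2 _ _ _ _ _ hI3, proj_lieEltC (-1) _ _ _ _ _ hI1,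
    proj_lieEltC 1 _ _ _ _ _ hI2, proj_lieEltC 0 _ _ _ _ _ hI4]
  simp only [smul_lieEltC, lieEltC_add]
  congr 1
  · rw [← smul_sub_add_conj_smul]
    simp only [neg_sq, h2, h3, Odd.neg_pow (by decide : Odd 3)]
    ring
  · simp only [neg_sq, h2, h3, Odd.neg_pow (by decide : Odd 3)]
    ring
  · simp only [neg_sq, h2, h3, Odd.neg_pow (by decide : Odd 3)]
    ring
  · simp only [neg_sq, h2, h3, Odd.neg_pow (by decide : Odd 3)]
    ring
  · have : (fun i => (((w₁.re • u + w₁.im • (Lj *ᵥ u)) i : ℝ) : ℂ)) = fun i =>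
        w₁ * ((1 / 2) * (u i - Complex.I * (Lj *ᵥ u) i))
          + starRingEnd ℂ w₁ * ((1 / 2) * (u i + Complex.I * (Lj *ᵥ u) i)) := by
      ext i
      rw [smul_sub_add_conj_smul]
      simp
    rw [this, Lj_mulVec]
    ext i
    simp only [neg_sq, h2]
    fin_cases i <;> simp [-Matrix.add_cons, -Matrix.cons_add, -Matrix.smul_cons] <;>
      ring_nf <;> simp only [h2] <;> ring_nf

/-! ### Derivatives of products -/

section Products

variable {z v : ℂ}

theorem fderiv_apply_coord {X : ℂ → V4} (hX : DifferentiableAt ℝ X z) (i : Fin 4) :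
    fderiv ℝ X z v i = fderiv ℝ (fun w => X w i) z v := by
  rw [(hasFDerivAt_pi'.1 hX.hasFDerivAt i).fderiv]
  rfl

theorem fderiv_dotProduct {X Y : ℂ → V4} (hX : DifferentiableAt ℝ X z)
    (hY : DifferentiableAt ℝ Y z) :
    fderiv ℝ (fun w => X w ⬝ᵥ Y w) z v = fderiv ℝ X z v ⬝ᵥ Y z + X z ⬝ᵥ fderiv ℝ Y z v := by
  have hX' := differentiableAt_pi.1 hX
  have hY' := differentiableAt_pi.1 hY
  simp only [dotProduct]
  rw [fderiv_fun_sum fun i _ => (hX' i).fun_mul (hY' i), _root_.sum_apply,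
    ← Finset.sum_add_distrib]
  refine Finset.sum_congr rfl fun i _ => ?_
  rw [fderiv_fun_mul (hX' i) (hY' i), fderiv_apply_coord hX, fderiv_apply_coord hY]
  simp only [_root_.add_apply, _root_.smul_apply, smul_eq_mul]
  ring

theorem matD_mul {n : Type} [Fintype n] {A B : ℂ → Matrix n n ℝ}
    (hA : ∀ i j, DifferentiableAt ℝ (fun w => A w i j) z)
    (hB : ∀ i j, DifferentiableAt ℝ (fun w => B w i j) z) :
    matD (fun w => A w * B w) z v = matD A z v * B z + A z * matD B z v := by
  ext i j
  simp only [matD, Matrix.of_apply, Matrix.mul_apply, Matrix.add_apply]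
  rw [fderiv_fun_sum fun k _ => (hA i k).fun_mul (hB k j), _root_.sum_apply,
    ← Finset.sum_add_distrib]
  refine Finset.sum_congr rfl fun k _ => ?_
  rw [fderiv_fun_mul (hA i k) (hB k j)]
  simp only [_root_.add_apply, _root_.smul_apply, smul_eq_mul]
  ring

theorem fderiv_mulVec {A : ℂ → M4} {X : ℂ → V4}
    (hA : ∀ i j, DifferentiableAt ℝ (fun w => A w i j) z) (hX : DifferentiableAt ℝ X z) :
    fderiv ℝ (fun w => A w *ᵥ X w) z v = matD A z v *ᵥ X z + A z *ᵥ fderiv ℝ X z v := by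
  have hX' := differentiableAt_pi.1 hX
  have hd : DifferentiableAt ℝ (fun w => A w *ᵥ X w) z := by
    refine differentiableAt_pi.2 fun i => ?_
    simp only [Matrix.mulVec, dotProduct]
    exact DifferentiableAt.fun_sum fun k _ => (hA i k).fun_mul (hX' k)
  ext i
  rw [fderiv_apply_coord hd]
  simp only [matD, Matrix.mulVec, dotProduct, Matrix.of_apply, Pi.add_apply]
  rw [fderiv_fun_sum fun k _ => (hA i k).fun_mul (hX' k), _root_.sum_apply,
    ← Finset.sum_add_distrib]
  refine Finset.sum_congr rfl fun k _ => ?_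
  rw [fderiv_fun_mul (hA i k) (hX' k), fderiv_apply_coord hX]
  simp only [_root_.add_apply, _root_.smul_apply, smul_eq_mul]
  ring

theorem differentiableAt_mulVec {A : ℂ → M4} {X : ℂ → V4}
    (hA : ∀ i j, DifferentiableAt ℝ (fun w => A w i j) z) (hX : DifferentiableAt ℝ X z) :
    DifferentiableAt ℝ (fun w => A w *ᵥ X w) z := by
  have hX' := differentiableAt_pi.1 hX
  refine differentiableAt_pi.2 fun i => ?_
  simp only [Matrix.mulVec, dotProduct]
  exact DifferentiableAt.fun_sum fun k _ => (hA i k).fun_mul (hX' k)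

theorem fderiv_const_mulVec (A : M4) {X : ℂ → V4} (hX : DifferentiableAt ℝ X z) :
    fderiv ℝ (fun w => A *ᵥ X w) z v = A *ᵥ fderiv ℝ X z v := by
  rw [fderiv_mulVec (A := fun _ => A) (fun _ _ => differentiableAt_const _) hX]
  have : matD (fun _ => A) z v = 0 := by ext i j; simp [matD]
  rw [this, Matrix.zero_mulVec, zero_add]

end Products

section Smooth

variable {Ω : Set ℂ}

theorem contDiffOn_mulVec {A : ℂ → M4} {X : ℂ → V4} (hA : SmoothOn Ω A)
    (hX : ContDiffOn ℝ ∞ X Ω) : ContDiffOn ℝ ∞ (fun w => A w *ᵥ X w) Ω := by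
  have hX' := contDiffOn_pi.1 hX
  refine contDiffOn_pi.2 fun i => ?_
  simp only [Matrix.mulVec, dotProduct]
  exact ContDiffOn.sum fun k _ => (hA i k).mul (hX' k)

theorem smoothOn_mul {n : Type} [Fintype n] {A B : ℂ → Matrix n n ℝ} (hA : SmoothOn Ω A)
    (hB : SmoothOn Ω B) : SmoothOn Ω fun w => A w * B w := fun i j => by
  simp only [Matrix.mul_apply]
  exact ContDiffOn.sum fun k _ => (hA i k).mul (hB k j)

theorem smoothOn_const {n : Type} (A : Matrix n n ℝ) : SmoothOn Ω fun _ => A :=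
  fun _ _ => contDiffOn_const

theorem contDiffOn_dotProduct {X Y : ℂ → V4} (hX : ContDiffOn ℝ ∞ X Ω)
    (hY : ContDiffOn ℝ ∞ Y Ω) : ContDiffOn ℝ ∞ (fun w => X w ⬝ᵥ Y w) Ω := by
  have hX' := contDiffOn_pi.1 hX
  have hY' := contDiffOn_pi.1 hY
  simp only [dotProduct]
  exact ContDiffOn.sum fun k _ => (hX' k).mul (hY' k)

theorem SmoothOn.differentiableAt {n : Type} {A : ℂ → Matrix n n ℝ} (hA : SmoothOn Ω A)
    (hΩ : IsOpen Ω) {z : ℂ} (hz : z ∈ Ω) (i j : n) :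
    DifferentiableAt ℝ (fun w => A w i j) z :=
  ((hA i j).differentiableOn (by simp)).differentiableAt (hΩ.mem_nhds hz)

theorem differentiableAt_of_contDiffOn {G : Type*} [NormedAddCommGroup G] [NormedSpace ℝ G]
    {f : ℂ → G} (hf : ContDiffOn ℝ ∞ f Ω) (hΩ : IsOpen Ω) {z : ℂ} (hz : z ∈ Ω) :
    DifferentiableAt ℝ f z :=
  (hf.differentiableOn (by simp)).differentiableAt (hΩ.mem_nhds hz)

theorem contDiffOn_fderiv_apply {G : Type*} [NormedAddCommGroup G] [NormedSpace ℝ G]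
    {f : ℂ → G} (hf : ContDiffOn ℝ ∞ f Ω) (hΩ : IsOpen Ω) (v : ℂ) :
    ContDiffOn ℝ ∞ (fun z => fderiv ℝ f z v) Ω :=
  (hf.fderiv_of_isOpen hΩ (by simp)).clm_apply contDiffOn_const

/-- Second partial derivatives commute. -/
theorem fderiv_fderiv_comm {G : Type*} [NormedAddCommGroup G] [NormedSpace ℝ G]
    {f : ℂ → G} (hf : ContDiffOn ℝ ∞ f Ω) (hΩ : IsOpen Ω) {z : ℂ} (hz : z ∈ Ω) (v w : ℂ) :
    fderiv ℝ (fun p => fderiv ℝ f p v) z w = fderiv ℝ (fun p => fderiv ℝ f p w) z v := by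
  have hd : DifferentiableAt ℝ (fderiv ℝ f) z :=
    differentiableAt_of_contDiffOn (hf.fderiv_of_isOpen hΩ (by simp)) hΩ hz
  have h (a b : ℂ) : fderiv ℝ (fun p => fderiv ℝ f p a) z b = fderiv ℝ (fderiv ℝ f) z b a := by
    rw [fderiv_clm_apply hd (differentiableAt_const _)]
    simp
  rw [h, h]
  have hs : IsSymmSndFDerivAt ℝ f z :=
    (hf.contDiffAt (hΩ.mem_nhds hz)).isSymmSndFDerivAt
      (by
      simpa using (show (2 : ℕ∞ω) ≤ ∞ from
        WithTop.coe_le_coe.2 (le_top : (2 : ℕ∞) ≤ ⊤)))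
  exact hs w v

end Smooth

/-! ### The first variation of area -/

/-- Differentiation under the integral sign over a compact set. -/
theorem hasDerivAt_setIntegral_of_isCompact {K : Set ℂ} (hK : IsCompact K) {O : Set (ℝ × ℂ)}
    (hO : IsOpen O) (hKO : ∀ z ∈ K, ((0 : ℝ), z) ∈ O) {f f' : ℝ → ℂ → ℝ}
    (hf : ContinuousOn (fun p : ℝ × ℂ => f p.1 p.2) O)
    (hf' : ContinuousOn (fun p : ℝ × ℂ => f' p.1 p.2) O)
    (hd : ∀ p ∈ O, HasDerivAt (fun t => f t p.2) (f' p.1 p.2) p.1) :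
    HasDerivAt (fun t => ∫ z in K, f t z) (∫ z in K, f' 0 z) 0 := by
  have hslice : ∀ g : ℝ → ℂ → ℝ, ContinuousOn (fun p : ℝ × ℂ => g p.1 p.2) O →
      ∀ t, (∀ z ∈ K, (t, z) ∈ O) → ContinuousOn (g t) K := fun g hg t ht =>
    hg.comp (f := fun z => (t, z)) (by fun_prop) ht
  obtain ⟨C, hC⟩ := hK.exists_bound_of_continuousOn (hslice f' hf' 0 hKO)
  -- Compactness of `K` turns the bound at `t = 0` into one valid for all `z ∈ K` and all `t` near
  -- `0`; the constant `C + 1` is the dominating function.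
  have hev : ∀ᶠ t in nhds (0 : ℝ), ∀ z ∈ K, (t, z) ∈ O ∧ ‖f' t z‖ < C + 1 := by
    refine hK.eventually_forall_of_forall_eventually fun z hz => ?_
    have hc := (hf'.continuousAt (hO.mem_nhds (hKO z hz))).norm
    refine (hO.eventually_mem (hKO z hz)).and (hc.eventually (p := fun y => y < C + 1) ?_)
    exact Iio_mem_nhds (by linarith [hC z hz])
  have hfin : volume K ≠ ⊤ := hK.measure_lt_top.ne
  refine (hasDerivAt_integral_of_dominated_loc_of_deriv_le (bound := fun _ => C + 1)
    (F' := f') hev ?_ ?_ ?_ ?_ ?_ ?_).2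
  · filter_upwards [hev] with t ht
    exact (hslice f hf t fun z hz => (ht z hz).1).aestronglyMeasurable hK.measurableSet
  · exact (hslice f hf 0 hKO).integrableOn_compact hK
  · exact (hslice f' hf' 0 hKO).aestronglyMeasurable hK.measurableSet
  · filter_upwards [ae_restrict_mem hK.measurableSet] with z hz t ht
    exact (ht z hz).2.le
  · exact integrableOn_const hfin
  · filter_upwards [ae_restrict_mem hK.measurableSet] with z hz t ht
    exact hd (t, z) (ht z hz).1

theorem hasDerivAt_affine_dotProduct (p m q n : V4) (t : ℝ) :
    HasDerivAt (fun t : ℝ => (p + t • m) ⬝ᵥ (q + t • n))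
      (m ⬝ᵥ (q + t • n) + (p + t • m) ⬝ᵥ n) t := by
  have h : ∀ i, HasDerivAt (fun t : ℝ => (p i + t * m i) * (q i + t * n i))
      (m i * (q i + t * n i) + (p i + t * m i) * n i) t := fun i => by
    have h1 : HasDerivAt (fun t : ℝ => p i + t * m i) (m i) t := by
      simpa using ((hasDerivAt_id t).mul_const (m i)).const_add (p i)
    have h2 : HasDerivAt (fun t : ℝ => q i + t * n i) (n i) t := by
      simpa using ((hasDerivAt_id t).mul_const (n i)).const_add (q i)
    exact h1.mul h2
  have := HasDerivAt.fun_sum (u := Finset.univ) fun i _ => h i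
  rw [Finset.sum_add_distrib] at this
  exact this

/-- At `t = 0` the two diagonal metric coefficients agree and the mixed one vanishes, so the
derivative of the area density reduces to that of the Dirichlet energy. -/
theorem hasDerivAt_integral_areaDensity {Ω : Set ℂ} (hΩ : IsOpen Ω) {X V : ℂ → V4}
    (hX : IsConformalLagrangianImmersion Ω X) (hV : ContDiff ℝ ∞ V)
    (hVc : HasCompactSupport V) (hVs : tsupport V ⊆ Ω) :
    HasDerivAt (fun t : ℝ => ∫ z in tsupport V, areaDensity (fun w => X w + t • V w) z)
      (∫ z in tsupport V, (dX X z ⬝ᵥ dX V z + dY X z ⬝ᵥ dY V z)) 0 := by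
  have hVo : ContDiffOn ℝ ∞ V Ω := hV.contDiffOn
  have cp : ContinuousOn (dX X) Ω := (contDiffOn_fderiv_apply hX.smooth hΩ 1).continuousOn
  have cq : ContinuousOn (dY X) Ω := (contDiffOn_fderiv_apply hX.smooth hΩ Complex.I).continuousOn
  have cm : ContinuousOn (dX V) Ω := (contDiffOn_fderiv_apply hVo hΩ 1).continuousOn
  have cn : ContinuousOn (dY V) Ω := (contDiffOn_fderiv_apply hVo hΩ Complex.I).continuousOn
  let P : ℝ → ℂ → V4 := fun t z => dX X z + t • dX V z
  let R : ℝ → ℂ → V4 := fun t z => dY X z + t • dY V z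
  let Q : ℝ → ℂ → ℝ := fun t z => (P t z ⬝ᵥ P t z) * (R t z ⬝ᵥ R t z) - (P t z ⬝ᵥ R t z) ^ 2
  let Q' : ℝ → ℂ → ℝ := fun t z =>
    (dX V z ⬝ᵥ P t z + P t z ⬝ᵥ dX V z) * (R t z ⬝ᵥ R t z)
      + (P t z ⬝ᵥ P t z) * (dY V z ⬝ᵥ R t z + R t z ⬝ᵥ dY V z)
      - 2 * (P t z ⬝ᵥ R t z) * (dX V z ⬝ᵥ R t z + P t z ⬝ᵥ dY V z)
  have lift : ∀ {g : ℂ → V4}, ContinuousOn g Ω →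
      ContinuousOn (fun p : ℝ × ℂ => g p.2) (Set.univ ×ˢ Ω) := fun hg =>
    hg.comp continuousOn_snd fun p hp => hp.2
  have dotc : ∀ {f g : ℝ × ℂ → V4}, ContinuousOn f (Set.univ ×ˢ Ω) →
      ContinuousOn g (Set.univ ×ˢ Ω) →
      ContinuousOn (fun p => f p ⬝ᵥ g p) (Set.univ ×ˢ Ω) := fun hf hg => by
    simp only [dotProduct]
    exact continuousOn_finsetSum _ fun i _ =>
      ((continuousOn_pi.1 hf) i).mul ((continuousOn_pi.1 hg) i)
  have cP : ContinuousOn (fun p : ℝ × ℂ => P p.1 p.2) (Set.univ ×ˢ Ω) :=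
    (lift cp).add (continuousOn_fst.smul (lift cm))
  have cR : ContinuousOn (fun p : ℝ × ℂ => R p.1 p.2) (Set.univ ×ˢ Ω) :=
    (lift cq).add (continuousOn_fst.smul (lift cn))
  have cQ : ContinuousOn (fun p : ℝ × ℂ => Q p.1 p.2) (Set.univ ×ˢ Ω) :=
    ((dotc cP cP).mul (dotc cR cR)).sub ((dotc cP cR).pow 2)
  have cQ' : ContinuousOn (fun p : ℝ × ℂ => Q' p.1 p.2) (Set.univ ×ˢ Ω) :=
    ((((dotc (lift cm) cP).add (dotc cP (lift cm))).mul (dotc cR cR)).add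
      ((dotc cP cP).mul ((dotc (lift cn) cR).add (dotc cR (lift cn))))).sub
      ((continuousOn_const.mul (dotc cP cR)).mul ((dotc (lift cm) cR).add (dotc cP (lift cn))))
  have dQ : ∀ t z, HasDerivAt (fun t => Q t z) (Q' t z) t := fun t z => by
    have h1 := hasDerivAt_affine_dotProduct (dX X z) (dX V z) (dX X z) (dX V z) t
    have h2 := hasDerivAt_affine_dotProduct (dY X z) (dY V z) (dY X z) (dY V z) t
    have h3 := hasDerivAt_affine_dotProduct (dX X z) (dX V z) (dY X z) (dY V z) t
    refine ((h1.mul h2).sub (h3.pow 2)).congr_deriv ?_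
    simp [Q', P, R]
  -- The varied map may fail to be an immersion for large `t`; the square root is differentiated
  -- only where the Gram determinant `Q` is positive.
  let O : Set (ℝ × ℂ) := (Set.univ ×ˢ Ω) ∩ (fun p : ℝ × ℂ => Q p.1 p.2) ⁻¹' Set.Ioi 0
  have hO : IsOpen O := cQ.isOpen_inter_preimage (isOpen_univ.prod hΩ) isOpen_Ioi
  have hP0 : ∀ z, P 0 z = dX X z := fun z => by simp [P]
  have hR0 : ∀ z, R 0 z = dY X z := fun z => by simp [R]
  have hQ0 : ∀ z ∈ Ω, Q 0 z = (dX X z ⬝ᵥ dX X z) ^ 2 := fun z hz => by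
    simp only [Q, hP0, hR0, hX.orthogonal z hz, ← hX.conformal z hz]
    ring
  have main := hasDerivAt_setIntegral_of_isCompact (K := tsupport V) hVc hO
    (f := fun t z => √(Q t z)) (f' := fun t z => Q' t z / (2 * √(Q t z)))
    (fun z hz => ⟨⟨trivial, hVs hz⟩, by
      change 0 < Q 0 z
      rw [hQ0 z (hVs hz)]
      have := hX.immersion z (hVs hz)
      positivity⟩)
    ((cQ.mono Set.inter_subset_left).sqrt)
    ((cQ'.mono Set.inter_subset_left).div
      (continuousOn_const.mul (cQ.mono Set.inter_subset_left).sqrt) fun p hp => by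
        have : 0 < √(Q p.1 p.2) := Real.sqrt_pos.2 hp.2
        positivity)
    (fun p hp => (dQ p.1 p.2).sqrt (ne_of_gt hp.2))
  have hK : MeasurableSet (tsupport V) := (isClosed_tsupport V).measurableSet
  convert main using 1
  · funext t
    refine setIntegral_congr_fun hK fun z hz => ?_
    have hXd := differentiableAt_of_contDiffOn hX.smooth hΩ (hVs hz)
    have hVd := differentiableAt_of_contDiffOn hVo hΩ (hVs hz)
    have hw : ∀ v, fderiv ℝ (fun w => X w + t • V w) z v =
        fderiv ℝ X z v + t • fderiv ℝ V z v := fun v => by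
      rw [fderiv_fun_add hXd (hVd.fun_const_smul t), fderiv_fun_const_smul hVd]
      rfl
    simp only [areaDensity, dX, dY, hw]
    rfl
  · refine setIntegral_congr_fun hK fun z hz => ?_
    have hpos := hX.immersion z (hVs hz)
    simp only [hQ0 z (hVs hz), Real.sqrt_sq hpos.le]
    simp only [Q', hP0, hR0, hX.orthogonal z (hVs hz), ← hX.conformal z (hVs hz)]
    rw [dotProduct_comm (dX V z) (dX X z), dotProduct_comm (dY V z) (dY X z)]
    field_simp
    ring

/-! ### Moving frames of conformal Lagrangian immersions -/

/-- The map `(F, X)` is a frame, with Maurer-Cartan form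
`(a L_i + b₁ R_i + b₂ R_j + b₃ R_k, u dx + L_j u dy)`. -/
structure IsFrame (Ω : Set ℂ) (F : ℂ → M4) (X : ℂ → V4) (a b₁ b₂ b₃ : ℂ → ℂ → ℝ)
    (u : ℂ → V4) : Prop where
  smooth_F : SmoothOn Ω F
  smooth_X : ContDiffOn ℝ ∞ X Ω
  smooth_u : ContDiffOn ℝ ∞ u Ω
  smooth_a : ∀ v, ContDiffOn ℝ ∞ (fun z => a z v) Ω
  smooth_b₁ : ∀ v, ContDiffOn ℝ ∞ (fun z => b₁ z v) Ω
  smooth_b₂ : ∀ v, ContDiffOn ℝ ∞ (fun z => b₂ z v) Ω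
  smooth_b₃ : ∀ v, ContDiffOn ℝ ∞ (fun z => b₃ z v) Ω
  orthogonal : ∀ z ∈ Ω, (F z)ᵀ * F z = 1
  commute : ∀ z ∈ Ω, F z * Li = Li * F z
  matD_F : ∀ z ∈ Ω, ∀ v, matD F z v = F z * linPart (a z v) (b₁ z v) (b₂ z v) (b₃ z v)
  fderiv_X : ∀ z ∈ Ω, ∀ v, fderiv ℝ X z v = F z *ᵥ (v.re • u z + v.im • (Lj *ᵥ u z))
  pos : ∀ z ∈ Ω, 0 < u z ⬝ᵥ u z

theorem mulVec_dotProduct_mulVec_of_orthogonal {G : M4} (hG : Gᵀ * G = 1) (x y : V4) :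
    (G *ᵥ x) ⬝ᵥ (G *ᵥ y) = x ⬝ᵥ y := by
  rw [Matrix.dotProduct_mulVec, ← Matrix.mulVec_transpose, Matrix.mulVec_mulVec, hG,
    Matrix.one_mulVec]

theorem omega_mulVec_mulVec {G : M4} (hG : Gᵀ * G = 1) (hGL : G * Li = Li * G) (x y : V4) :
    omega (G *ᵥ x) (G *ᵥ y) = omega x y := by
  rw [omega, Matrix.mulVec_mulVec, ← hGL, ← Matrix.mulVec_mulVec,
    mulVec_dotProduct_mulVec_of_orthogonal hG, omega]

theorem matD_congr {n : Type} {Ω : Set ℂ} (hΩ : IsOpen Ω) {A B : ℂ → Matrix n n ℝ}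
    (h : ∀ z ∈ Ω, A z = B z) {z : ℂ} (hz : z ∈ Ω) (v : ℂ) : matD A z v = matD B z v := by
  ext i j
  simp only [matD, Matrix.of_apply]
  have : (fun w => A w i j) =ᶠ[nhds z] fun w => B w i j := by
    filter_upwards [hΩ.mem_nhds hz] with w hw
    rw [h w hw]
  rw [this.fderiv_eq]

theorem fderiv_congr_of_isOpen {G : Type*} [NormedAddCommGroup G] [NormedSpace ℝ G] {Ω : Set ℂ}
    (hΩ : IsOpen Ω) {f g : ℂ → G} (h : ∀ z ∈ Ω, f z = g z) {z : ℂ} (hz : z ∈ Ω) :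
    fderiv ℝ f z = fderiv ℝ g z := by
  have : f =ᶠ[nhds z] g := by
    filter_upwards [hΩ.mem_nhds hz] with w hw using h w hw
  rw [this.fderiv_eq]

namespace IsFrame

variable {Ω : Set ℂ} {F : ℂ → M4} {X : ℂ → V4} {a b₁ b₂ b₃ : ℂ → ℂ → ℝ} {u : ℂ → V4}

theorem dX_eq (h : IsFrame Ω F X a b₁ b₂ b₃ u) {z : ℂ} (hz : z ∈ Ω) : dX X z = F z *ᵥ u z := by
  rw [dX, h.fderiv_X z hz]; simp

theorem dY_eq (h : IsFrame Ω F X a b₁ b₂ b₃ u) {z : ℂ} (hz : z ∈ Ω) :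
    dY X z = F z *ᵥ (Lj *ᵥ u z) := by
  rw [dY, h.fderiv_X z hz]; simp

theorem isConformalLagrangianImmersion (h : IsFrame Ω F X a b₁ b₂ b₃ u) :
    IsConformalLagrangianImmersion Ω X where
  smooth := h.smooth_X
  immersion z hz := by
    rw [h.dX_eq hz, mulVec_dotProduct_mulVec_of_orthogonal (h.orthogonal z hz)]
    exact h.pos z hz
  conformal z hz := by
    rw [h.dX_eq hz, h.dY_eq hz, mulVec_dotProduct_mulVec_of_orthogonal (h.orthogonal z hz),
      mulVec_dotProduct_mulVec_of_orthogonal (h.orthogonal z hz), dotProduct_Lj_mulVec_Lj_mulVec]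
  orthogonal z hz := by
    rw [h.dX_eq hz, h.dY_eq hz, mulVec_dotProduct_mulVec_of_orthogonal (h.orthogonal z hz),
      dotProduct_Lj_mulVec_self]
  lagrangian z hz := by
    rw [h.dX_eq hz, h.dY_eq hz, omega_mulVec_mulVec (h.orthogonal z hz) (h.commute z hz),
      omega_self_Lj]

theorem smooth_linPart (h : IsFrame Ω F X a b₁ b₂ b₃ u) (v : ℂ) :
    SmoothOn Ω fun z => linPart (a z v) (b₁ z v) (b₂ z v) (b₃ z v) := fun i j => by
  have ha := h.smooth_a v
  have h1 := h.smooth_b₁ v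
  have h2 := h.smooth_b₂ v
  have h3 := h.smooth_b₃ v
  simp only [linPart, Matrix.add_apply, Matrix.smul_apply, smul_eq_mul]
  fun_prop

/-- The form `a` is closed. -/
theorem closed (h : IsFrame Ω F X a b₁ b₂ b₃ u) (hΩ : IsOpen Ω) {z : ℂ} (hz : z ∈ Ω) :
    fderiv ℝ (fun w => a w Complex.I) z 1 = fderiv ℝ (fun w => a w 1) z Complex.I := by
  let A : ℂ → ℂ → M4 := fun v z => linPart (a z v) (b₁ z v) (b₂ z v) (b₃ z v)
  have hFd := fun i j => h.smooth_F.differentiableAt hΩ hz i j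
  have hAd := fun v i j => (h.smooth_linPart v).differentiableAt hΩ hz i j
  have key : ∀ v w, matD (fun p => matD F p v) z w
      = F z * (A w z * A v z + matD (A v) z w) := fun v w => by
    rw [matD_congr hΩ (B := fun p => F p * A v p) (fun p hp => h.matD_F p hp v) hz,
      matD_mul hFd (hAd v), h.matD_F z hz w, mul_add, mul_assoc]
  have hsymm : matD (fun p => matD F p Complex.I) z 1 = matD (fun p => matD F p 1) z Complex.I := by
    ext i j
    simp only [matD, Matrix.of_apply]
    exact fderiv_fderiv_comm (h.smooth_F i j) hΩ hz _ _
  rw [key, key] at hsymm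
  have hc := congrArg ((F z)ᵀ * ·) hsymm
  simp only [← mul_assoc (F z)ᵀ, h.orthogonal z hz, one_mul] at hc
  -- The entries `(1, 0)` and `(3, 2)` of `linPart` are `a + b₁` and `a - b₁`. Adding them isolates
  -- `a`, and the commutator drops out because it has no `L_i` component.
  have e1 := congrFun (congrFun hc 1) 0
  have e2 := congrFun (congrFun hc 3) 2
  have hd1 := fun v => differentiableAt_of_contDiffOn (h.smooth_a v) hΩ hz
  have hd2 := fun v => differentiableAt_of_contDiffOn (h.smooth_b₁ v) hΩ hz
  simp only [A, matD, linPart_apply, Matrix.add_apply, Matrix.of_apply, Matrix.mul_apply,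
    Fin.sum_univ_four] at e1 e2
  simp only [Matrix.cons_val, fderiv_fun_add (hd1 _) (hd2 _), fderiv_fun_sub (hd1 _) (hd2 _),
    _root_.add_apply, _root_.sub_apply] at e1 e2
  linarith

/-- The Laplacian of `X`. -/
theorem laplacian (h : IsFrame Ω F X a b₁ b₂ b₃ u) (hΩ : IsOpen Ω) {z : ℂ} (hz : z ∈ Ω) :
    fderiv ℝ (dX X) z 1 + fderiv ℝ (dY X) z Complex.I
      = (2 : ℝ) • (Li *ᵥ (a z 1 • dX X z + a z Complex.I • dY X z)) := by
  have hFd := fun i j => h.smooth_F.differentiableAt hΩ hz i j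
  have hud := differentiableAt_of_contDiffOn h.smooth_u hΩ hz
  have hLd : DifferentiableAt ℝ (fun w => Lj *ᵥ u w) z :=
    differentiableAt_mulVec (A := fun _ => Lj) (fun _ _ => differentiableAt_const _) hud
  let A : ℂ → M4 := fun v => linPart (a z v) (b₁ z v) (b₂ z v) (b₃ z v)
  have kX : ∀ v, fderiv ℝ (dX X) z v = F z *ᵥ (A v *ᵥ u z + fderiv ℝ u z v) := fun v => by
    rw [fderiv_congr_of_isOpen hΩ (fun w hw => h.dX_eq hw) hz, fderiv_mulVec hFd hud,
      h.matD_F z hz, ← Matrix.mulVec_mulVec, ← Matrix.mulVec_add]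
  have kY : ∀ v, fderiv ℝ (dY X) z v = F z *ᵥ (A v *ᵥ (Lj *ᵥ u z) + Lj *ᵥ fderiv ℝ u z v) :=
    fun v => by
    rw [fderiv_congr_of_isOpen hΩ (fun w hw => h.dY_eq hw) hz, fderiv_mulVec hFd hLd,
      h.matD_F z hz, ← Matrix.mulVec_mulVec, ← Matrix.mulVec_add, fderiv_const_mulVec Lj hud]
  -- Applying `L_j` to `X_yx = X_xy`, pulled back by `F`, expresses `u_x + L_j u_y` through the
  -- Maurer–Cartan form. In `ΔX` the `R_q` terms then cancel, since they commute with `L_j`, while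
  -- the `L_i` terms double, since `L_i` anticommutes with it.
  have hsymm : fderiv ℝ (dY X) z 1 = fderiv ℝ (dX X) z Complex.I :=
    fderiv_fderiv_comm h.smooth_X hΩ hz _ _
  rw [kX, kY] at hsymm
  have hc := congrArg ((F z)ᵀ *ᵥ ·) hsymm
  simp only [Matrix.mulVec_mulVec _ (F z)ᵀ, h.orthogonal z hz, Matrix.one_mulVec] at hc
  rw [kX, kY, h.dX_eq hz, h.dY_eq hz, ← Matrix.mulVec_smul, ← Matrix.mulVec_smul,
    ← Matrix.mulVec_smul, ← Matrix.mulVec_add, ← Matrix.mulVec_add, ← Matrix.mulVec_smul,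
    Matrix.mulVec_mulVec _ Li, ← h.commute z hz, ← Matrix.mulVec_mulVec _ (F z)]
  congr 1
  have e0 := congrFun hc 0
  have e1 := congrFun hc 1
  have e2 := congrFun hc 2
  have e3 := congrFun hc 3
  simp only [A, Lj_mulVec, linPart_apply, Matrix.mulVec, dotProduct, Fin.sum_univ_four,
    Pi.add_apply, Matrix.of_apply, Matrix.cons_val] at e0 e1 e2 e3
  ext i
  fin_cases i <;>
  simp only [A, Lj_mulVec, linPart_apply, Li, Matrix.mulVec, dotProduct, Fin.sum_univ_four,
    Pi.add_apply, Pi.smul_apply, smul_eq_mul, Matrix.of_apply, Matrix.cons_val, Fin.zero_eta,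
    Fin.mk_one, Fin.reduceFinMk] <;>
  linarith

end IsFrame

/-! ### Hamiltonian stationarity and coclosedness -/

/-- A function that is smooth on an open set, times a smooth function supported there. -/
theorem contDiff_mul_of_tsupport_subset {Ω : Set ℂ} (hΩ : IsOpen Ω) {f g : ℂ → ℝ}
    (hf : ContDiffOn ℝ ∞ f Ω) (hg : ContDiff ℝ ∞ g) (hs : tsupport g ⊆ Ω) :
    ContDiff ℝ ∞ fun z => f z * g z := by
  refine contDiff_iff_contDiffAt.2 fun z => ?_
  by_cases hz : z ∈ Ω
  · exact (hf.contDiffAt (hΩ.mem_nhds hz)).mul hg.contDiffAt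
  · have : (fun z => f z * g z) =ᶠ[nhds z] fun _ => 0 := by
      filter_upwards [notMem_tsupport_iff_eventuallyEq.1 fun h => hz (hs h)] with w hw
      rw [hw]; simp
    exact contDiffAt_const.congr_of_eventuallyEq this

theorem contDiff_dotProduct_of_tsupport_subset {Ω : Set ℂ} (hΩ : IsOpen Ω) {f g : ℂ → V4}
    (hf : ContDiffOn ℝ ∞ f Ω) (hg : ContDiff ℝ ∞ g) (hs : tsupport g ⊆ Ω) :
    ContDiff ℝ ∞ fun z => f z ⬝ᵥ g z := by
  simp only [dotProduct]
  refine ContDiff.sum fun i _ => contDiff_mul_of_tsupport_subset hΩ (contDiffOn_pi.1 hf i)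
    (contDiff_pi.1 hg i) ((closure_mono ?_).trans hs)
  intro z hz hgz
  exact hz (congrFun hgz i)

theorem integral_fderiv_eq_zero {f : ℂ → ℝ} (hf : ContDiff ℝ ∞ f) (hc : HasCompactSupport f)
    (v : ℂ) : ∫ z, fderiv ℝ f z v = 0 := by
  have hd : Continuous fun z => fderiv ℝ f z v :=
    (hf.continuous_fderiv (by simp)).clm_apply continuous_const
  have hi : Integrable fun z => fderiv ℝ f z v :=
    hd.integrable_of_hasCompactSupport (hc.fderiv_apply ℝ v)
  have hfi : Integrable f := hf.continuous.integrable_of_hasCompactSupport hc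
  have := integral_mul_fderiv_eq_neg_fderiv_mul_of_integrable (μ := volume)
    (f := fun _ : ℂ => (1 : ℝ)) (g := f) (v := v) (by simp) (by simpa using hi) (by simpa using hfi)
    (fun _ _ => differentiableAt_const _) (fun z _ => hf.differentiable (by simp) z)
  simpa using this

/-- The divergence of a 1-form. -/
noncomputable def divForm (a : ℂ → ℂ → ℝ) (z : ℂ) : ℝ :=
  fderiv ℝ (fun w => a w 1) z 1 + fderiv ℝ (fun w => a w Complex.I) z Complex.I

theorem fderiv_apply_eq_re_im {G : Type*} [NormedAddCommGroup G] [NormedSpace ℝ G]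
    (L : ℂ →L[ℝ] G) (v : ℂ) : L v = v.re • L 1 + v.im • L Complex.I := by
  conv_lhs => rw [show v = v.re • (1 : ℂ) + v.im • Complex.I by
    apply Complex.ext <;> simp]
  rw [map_add, map_smul, map_smul]

namespace IsFrame

variable {Ω : Set ℂ} {F : ℂ → M4} {X : ℂ → V4} {a b₁ b₂ b₃ : ℂ → ℂ → ℝ} {u : ℂ → V4}

/-- The compactly supported field with components `⟨X_x, V⟩ + 2 a_x g` and `⟨X_y, V⟩ + 2 a_y g` has
a divergence of integral zero. By the formula for `ΔX` and `⟨J dX, V⟩ = -dg`, that divergence is the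
left integrand plus `2 g div a`. -/
theorem integral_first_variation (h : IsFrame Ω F X a b₁ b₂ b₃ u) (hΩ : IsOpen Ω)
    {g : ℂ → ℝ} {V : ℂ → V4} (hg : ContDiff ℝ ∞ g) (hgc : HasCompactSupport g)
    (hgs : tsupport g ⊆ Ω) (hV : ContDiff ℝ ∞ V) (hVc : HasCompactSupport V)
    (hVs : tsupport V ⊆ Ω)
    (hVg : ∀ z ∈ Ω, ∀ v : ℂ, omega (V z) (fderiv ℝ X z v) = fderiv ℝ g z v) :
    ∫ z in tsupport V, (dX X z ⬝ᵥ dX V z + dY X z ⬝ᵥ dY V z)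
      = -2 * ∫ z, g z * divForm a z := by
  have sX : ContDiffOn ℝ ∞ (dX X) Ω := contDiffOn_fderiv_apply h.smooth_X hΩ 1
  have sY : ContDiffOn ℝ ∞ (dY X) Ω := contDiffOn_fderiv_apply h.smooth_X hΩ Complex.I
  have s1 := h.smooth_a 1
  have s2 := h.smooth_a Complex.I
  let P : ℂ → ℝ := fun z => dX X z ⬝ᵥ V z + 2 * (a z 1 * g z)
  let R : ℂ → ℝ := fun z => dY X z ⬝ᵥ V z + 2 * (a z Complex.I * g z)
  have hP : ContDiff ℝ ∞ P := (contDiff_dotProduct_of_tsupport_subset hΩ sX hV hVs).add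
    (contDiff_const.mul (contDiff_mul_of_tsupport_subset hΩ s1 hg hgs))
  have hR : ContDiff ℝ ∞ R := (contDiff_dotProduct_of_tsupport_subset hΩ sY hV hVs).add
    (contDiff_const.mul (contDiff_mul_of_tsupport_subset hΩ s2 hg hgs))
  have hzero : ∀ z, z ∉ tsupport V ∪ tsupport g → P z = 0 ∧ R z = 0 := fun z hz => by
    have h1 : V z = 0 := image_eq_zero_of_notMem_tsupport fun h => hz (Or.inl h)
    have h2 : g z = 0 := image_eq_zero_of_notMem_tsupport fun h => hz (Or.inr h)
    simp [P, R, h1, h2]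
  have hPc : HasCompactSupport P := HasCompactSupport.intro (hVc.isCompact.union hgc.isCompact)
    fun z hz => (hzero z hz).1
  have hRc : HasCompactSupport R := HasCompactSupport.intro (hVc.isCompact.union hgc.isCompact)
    fun z hz => (hzero z hz).2
  have sdiv : ContDiffOn ℝ ∞ (divForm a) Ω :=
    (contDiffOn_fderiv_apply s1 hΩ 1).add (contDiffOn_fderiv_apply s2 hΩ Complex.I)
  have hig : Integrable fun z => divForm a z * g z :=
    (contDiff_mul_of_tsupport_subset hΩ sdiv hg hgs).continuous.integrable_of_hasCompactSupport
      hgc.mul_left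
  have hiP : Integrable fun z => fderiv ℝ P z 1 :=
    ((hP.continuous_fderiv (by simp)).clm_apply continuous_const).integrable_of_hasCompactSupport
      (hPc.fderiv_apply ℝ 1)
  have hiR : Integrable fun z => fderiv ℝ R z Complex.I :=
    ((hR.continuous_fderiv (by simp)).clm_apply continuous_const).integrable_of_hasCompactSupport
      (hRc.fderiv_apply ℝ Complex.I)
  have hpt : ∀ z, dX X z ⬝ᵥ dX V z + dY X z ⬝ᵥ dY V z
      = fderiv ℝ P z 1 + fderiv ℝ R z Complex.I - 2 * (divForm a z * g z) := fun z => by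
    by_cases hz : z ∈ Ω
    · have dXd := differentiableAt_of_contDiffOn sX hΩ hz
      have dYd := differentiableAt_of_contDiffOn sY hΩ hz
      have d1 := differentiableAt_of_contDiffOn s1 hΩ hz
      have d2 := differentiableAt_of_contDiffOn s2 hΩ hz
      have dV : DifferentiableAt ℝ V z := hV.differentiable (by simp) z
      have dg : DifferentiableAt ℝ g z := hg.differentiable (by simp) z
      have hdot : ∀ {Y : ℂ → V4}, DifferentiableAt ℝ Y z →
          DifferentiableAt ℝ (fun w => Y w ⬝ᵥ V w) z := fun hY => by
        simp only [dotProduct]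
        exact DifferentiableAt.fun_sum fun i _ =>
          (differentiableAt_pi.1 hY i).fun_mul (differentiableAt_pi.1 dV i)
      have hmain : ∀ {Y : ℂ → V4} {c : ℂ → ℝ} (v : ℂ), DifferentiableAt ℝ Y z →
          DifferentiableAt ℝ c z → fderiv ℝ (fun w => Y w ⬝ᵥ V w + 2 * (c w * g w)) z v
            = fderiv ℝ Y z v ⬝ᵥ V z + Y z ⬝ᵥ fderiv ℝ V z v
              + 2 * (fderiv ℝ c z v * g z + c z * fderiv ℝ g z v) := fun v hY hc => by
        rw [fderiv_fun_add (hdot hY) ((hc.fun_mul dg).const_mul 2),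
          fderiv_const_mul (hc.fun_mul dg), fderiv_fun_mul hc dg, _root_.add_apply,
          fderiv_dotProduct hY dV]
        simp only [_root_.add_apply, _root_.smul_apply, smul_eq_mul]
        ring
      have e1 : fderiv ℝ P z 1 = _ := hmain 1 dXd d1
      have e2 : fderiv ℝ R z Complex.I = _ := hmain Complex.I dYd d2
      have hlap := congrArg (· ⬝ᵥ V z) (h.laplacian hΩ hz)
      simp only [add_dotProduct, smul_dotProduct, Matrix.mulVec_add, Matrix.mulVec_smul,
        smul_eq_mul] at hlap
      have o1 : (Li *ᵥ V z) ⬝ᵥ dX X z = fderiv ℝ g z 1 := hVg z hz 1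
      have o2 : (Li *ᵥ V z) ⬝ᵥ dY X z = fderiv ℝ g z Complex.I := hVg z hz Complex.I
      rw [dotProduct_Li_mulVec, dotProduct_comm] at o1 o2
      rw [e1, e2, divForm, ← o1, ← o2]
      simp only [dX, dY] at hlap ⊢
      linear_combination -hlap
    · have hV0 : ∀ v, fderiv ℝ V z v = 0 := fun v => by
        rw [image_eq_zero_of_notMem_tsupport fun h => hz (hVs (tsupport_fderiv_subset ℝ h))]
        rfl
      have hg0 : g z = 0 := image_eq_zero_of_notMem_tsupport fun h => hz (hgs h)
      have hout : z ∉ tsupport V ∪ tsupport g := fun h => hz (Set.union_subset hVs hgs h)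
      have hopen : ∀ᶠ w in nhds z, w ∉ tsupport V ∪ tsupport g :=
        ((isClosed_tsupport V).union (isClosed_tsupport g)).isOpen_compl.eventually_mem hout
      have hP0 : P =ᶠ[nhds z] fun _ => 0 := hopen.mono fun w hw => (hzero w hw).1
      have hR0 : R =ᶠ[nhds z] fun _ => 0 := hopen.mono fun w hw => (hzero w hw).2
      rw [dX.eq_def V, dY.eq_def V, hV0, hV0, hP0.fderiv_eq, hR0.fderiv_eq, hg0]
      simp
  rw [setIntegral_eq_integral_of_forall_compl_eq_zero fun z hz => by
    have hV0 : fderiv ℝ V z = 0 :=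
      image_eq_zero_of_notMem_tsupport fun h => hz (tsupport_fderiv_subset ℝ h)
    simp [dX, dY, hV0]]
  simp only [hpt]
  rw [integral_sub (f := fun z => fderiv ℝ P z 1 + fderiv ℝ R z Complex.I) (hiP.add hiR)
    (hig.const_mul 2), integral_add hiP hiR,
    integral_fderiv_eq_zero hP hPc, integral_fderiv_eq_zero hR hRc, integral_const_mul]
  simp only [mul_comm (divForm a _)]
  ring

/-- Smooth functions with compact support generate Hamiltonian vector fields. -/
theorem exists_hamiltonian (h : IsFrame Ω F X a b₁ b₂ b₃ u) (hΩ : IsOpen Ω)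
    {g : ℂ → ℝ} (hg : ContDiff ℝ ∞ g) (hgc : HasCompactSupport g) (hgs : tsupport g ⊆ Ω) :
    ∃ V : ℂ → V4, ContDiff ℝ ∞ V ∧ HasCompactSupport V ∧ tsupport V ⊆ Ω ∧
      ∀ z ∈ Ω, ∀ v : ℂ, omega (V z) (fderiv ℝ X z v) = fderiv ℝ g z v := by
  have hX := h.isConformalLagrangianImmersion
  have sX : ContDiffOn ℝ ∞ (dX X) Ω := contDiffOn_fderiv_apply h.smooth_X hΩ 1
  have sY : ContDiffOn ℝ ∞ (dY X) Ω := contDiffOn_fderiv_apply h.smooth_X hΩ Complex.I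
  have sρ : ContDiffOn ℝ ∞ (fun z => (dX X z ⬝ᵥ dX X z)⁻¹) Ω :=
    (contDiffOn_dotProduct sX sX).inv fun z hz => (hX.immersion z hz).ne'
  -- `P` and `R` are dual to `X_x` and `X_y` under `ω`, because `X_x`, `X_y` are orthogonal of equal
  -- length and `J² = -1`.
  let P : ℂ → V4 := fun z => (dX X z ⬝ᵥ dX X z)⁻¹ • (-(Li *ᵥ dX X z))
  let R : ℂ → V4 := fun z => (dX X z ⬝ᵥ dX X z)⁻¹ • (-(Li *ᵥ dY X z))
  have sP : ContDiffOn ℝ ∞ P Ω := sρ.smul (contDiffOn_mulVec (smoothOn_const Li) sX).neg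
  have sR : ContDiffOn ℝ ∞ R Ω := sρ.smul (contDiffOn_mulVec (smoothOn_const Li) sY).neg
  let V : ℂ → V4 := fun z => fderiv ℝ g z 1 • P z + fderiv ℝ g z Complex.I • R z
  have hgv : ∀ v, ContDiff ℝ ∞ fun z => fderiv ℝ g z v := fun v =>
    (hg.fderiv_right (by simp)).clm_apply contDiff_const
  have hgvs : ∀ v, tsupport (fun z => fderiv ℝ g z v) ⊆ Ω := fun v =>
    (tsupport_fderiv_apply_subset ℝ v).trans hgs
  have hsub : tsupport V ⊆ tsupport g := by
    refine closure_minimal (fun z hz => ?_) (isClosed_tsupport g)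
    by_contra hzg
    have : fderiv ℝ g z = 0 :=
      image_eq_zero_of_notMem_tsupport fun h => hzg (tsupport_fderiv_subset ℝ h)
    exact hz (by simp [V, this])
  refine ⟨V, ?_, hgc.isCompact.of_isClosed_subset (isClosed_tsupport V) hsub, hsub.trans hgs,
    fun z hz v => ?_⟩
  · refine contDiff_pi.2 fun i => ?_
    have h1 := contDiff_mul_of_tsupport_subset hΩ (contDiffOn_pi.1 sP i) (hgv 1) (hgvs 1)
    have h2 := contDiff_mul_of_tsupport_subset hΩ (contDiffOn_pi.1 sR i) (hgv Complex.I)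
      (hgvs Complex.I)
    convert h1.add h2 using 1
    funext w
    simp only [V, Pi.add_apply, Pi.smul_apply, smul_eq_mul]
    ring
  · have hLL : ∀ x : V4, Li *ᵥ (Li *ᵥ x) = -x := fun x => by
      rw [Matrix.mulVec_mulVec, Li_mul_Li, Matrix.neg_mulVec, Matrix.one_mulVec]
    have hρ := (hX.immersion z hz).ne'
    rw [fderiv_apply_eq_re_im (fderiv ℝ X z) v, fderiv_apply_eq_re_im (fderiv ℝ g z) v]
    change (Li *ᵥ V z) ⬝ᵥ (v.re • dX X z + v.im • dY X z) = _
    have ho := hX.orthogonal z hz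
    have ho' := ho
    rw [dotProduct_comm] at ho'
    simp only [V, P, R, Matrix.mulVec_add, Matrix.mulVec_smul, Matrix.mulVec_neg, hLL, neg_neg,
      add_dotProduct, smul_dotProduct, dotProduct_add, dotProduct_smul, ho, ho',
      ← hX.conformal z hz, smul_eq_mul]
    field_simp
    ring

/-- `X` is Hamiltonian stationary exactly when the form `a` is coclosed. -/
theorem isHamiltonianStationary_iff (h : IsFrame Ω F X a b₁ b₂ b₃ u) (hΩ : IsOpen Ω) :
    IsHamiltonianStationary Ω X ↔ ∀ z ∈ Ω, divForm a z = 0 := by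
  have hX := h.isConformalLagrangianImmersion
  have sdiv : ContDiffOn ℝ ∞ (divForm a) Ω :=
    (contDiffOn_fderiv_apply (h.smooth_a 1) hΩ 1).add
      (contDiffOn_fderiv_apply (h.smooth_a Complex.I) hΩ Complex.I)
  constructor
  · intro hs
    have hint : ∀ g : ℂ → ℝ, ContDiff ℝ ∞ g → HasCompactSupport g → tsupport g ⊆ Ω →
        ∫ z, g z • divForm a z = 0 := fun g hg hgc hgs => by
      obtain ⟨V, hV, hVc, hVs, hVg⟩ := h.exists_hamiltonian hΩ hg hgc hgs
      have := (hs g V hg hgc hgs hV hVc hVs hVg).unique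
        (hasDerivAt_integral_areaDensity hΩ hX hV hVc hVs)
      rw [h.integral_first_variation hΩ hg hgc hgs hV hVc hVs hVg] at this
      simp only [smul_eq_mul]
      linarith
    -- Every test function is the Hamiltonian of some `V`, so the fundamental lemma of the calculus
    -- of variations applies; continuity of `divForm a` then removes the exceptional null set.
    have hae := hΩ.ae_eq_zero_of_integral_contDiff_smul_eq_zero
      (sdiv.continuousOn.locallyIntegrableOn hΩ.measurableSet) hint
    have hae' : divForm a =ᵐ[volume.restrict Ω] fun _ => 0 :=
      (ae_restrict_iff' hΩ.measurableSet).2 hae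
    exact Measure.eqOn_open_of_ae_eq hae' hΩ sdiv.continuousOn continuousOn_const
  · intro hdiv g V hg hgc hgs hV hVc hVs hVg
    have := hasDerivAt_integral_areaDensity hΩ hX hV hVc hVs
    rw [h.integral_first_variation hΩ hg hgc hgs hV hVc hVs hVg] at this
    refine this.congr_deriv ?_
    have h0 : ∀ z, g z * divForm a z = 0 := fun z => by
      by_cases hz : z ∈ Ω
      · rw [hdiv z hz, mul_zero]
      · rw [image_eq_zero_of_notMem_tsupport fun h => hz (hgs h), zero_mul]
    simp [h0]

end IsFrame

/-! ### The associated family of frames -/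

/-- A smooth closed 1-form `p dx + q dy` on a simply connected domain has a primitive that
vanishes at a given point. -/
theorem exists_smooth_primitive {G : Type*} [NormedAddCommGroup G] [NormedSpace ℝ G]
    [CompleteSpace G] {Ω : Set ℂ} (hΩ : IsOpen Ω) (hsc : IsSimplyConnected Ω) {p q : ℂ → G}
    (hp : ContDiffOn ℝ ∞ p Ω) (hq : ContDiffOn ℝ ∞ q Ω)
    (hpq : ∀ z ∈ Ω, fderiv ℝ q z 1 = fderiv ℝ p z Complex.I) (z₀ : ℂ) :
    ∃ g : ℂ → G, ContDiffOn ℝ ∞ g Ω ∧ g z₀ = 0 ∧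
      ∀ z ∈ Ω, ∀ v : ℂ, fderiv ℝ g z v = v.re • p z + v.im • q z := by
  let η : ℂ → ℂ →L[ℝ] G := fun z =>
    Complex.reCLM.smulRight (p z) + Complex.imCLM.smulRight (q z)
  have hη : ContDiffOn ℝ ∞ η Ω :=
    (contDiffOn_const.smulRight hp).add (contDiffOn_const.smulRight hq)
  have hd : ∀ z ∈ Ω, ∀ x y, fderiv ℝ η z x y = y.re • fderiv ℝ p z x + y.im • fderiv ℝ q z x :=
    fun z hz x y => by
    have hpd := differentiableAt_of_contDiffOn hp hΩ hz
    have hqd := differentiableAt_of_contDiffOn hq hΩ hz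
    have h1 : fderiv ℝ (fun w => η w y) z x = fderiv ℝ η z x y := by
      rw [fderiv_clm_apply (differentiableAt_of_contDiffOn hη hΩ hz) (differentiableAt_const _)]
      simp
    rw [← h1]
    change fderiv ℝ (fun w => y.re • p w + y.im • q w) z x = _
    rw [fderiv_fun_add (hpd.fun_const_smul _) (hqd.fun_const_smul _),
      fderiv_fun_const_smul hpd, fderiv_fun_const_smul hqd]
    rfl
  obtain ⟨g, hg⟩ := exists_primitive_of_closed hΩ hsc (hη.differentiableOn (by simp))
    fun z hz x y => by
      rw [hd z hz, hd z hz, fderiv_apply_eq_re_im (fderiv ℝ p z) x,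
        fderiv_apply_eq_re_im (fderiv ℝ q z) x, fderiv_apply_eq_re_im (fderiv ℝ p z) y,
        fderiv_apply_eq_re_im (fderiv ℝ q z) y, hpq z hz]
      module
  have hg' : ∀ z ∈ Ω, fderiv ℝ g z = η z := fun z hz => (hg z hz).fderiv
  have hgs : ContDiffOn ℝ ∞ g Ω := by
    rw [contDiffOn_infty_iff_fderiv_of_isOpen hΩ]
    exact ⟨fun z hz => (hg z hz).differentiableAt.differentiableWithinAt,
      hη.congr hg'⟩
  refine ⟨fun z => g z - g z₀, hgs.sub contDiffOn_const, sub_self _, fun z hz v => ?_⟩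
  rw [fderiv_sub_const, hg' z hz]
  rfl

/-- The rotation `exp (t L_i)`. -/
noncomputable def expLi (t : ℝ) : M4 := Real.cos t • (1 : M4) + Real.sin t • Li

theorem expLi_zero : expLi 0 = 1 := by simp [expLi]

theorem expLi_transpose_mul_self (t : ℝ) : (expLi t)ᵀ * expLi t = 1 := by
  simp only [expLi, Matrix.transpose_add, Matrix.transpose_smul, Matrix.transpose_one,
    Li_transpose, add_mul, mul_add, smul_mul_assoc, mul_smul_comm, one_mul, mul_one, neg_mul,
    smul_neg, Li_mul_Li, neg_neg]
  have := Real.sin_sq_add_cos_sq t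
  linear_combination (norm := module) this • (1 : M4)

theorem expLi_mul_Li (t : ℝ) : expLi t * Li = Li * expLi t := by
  simp [expLi, add_mul, mul_add]

theorem matD_expLi {φ : ℂ → ℝ} {z : ℂ} (hφ : DifferentiableAt ℝ φ z) (v : ℂ) :
    matD (fun w => expLi (φ w)) z v = fderiv ℝ φ z v • (expLi (φ z) * Li) := by
  have hr : expLi (φ z) * Li = -Real.sin (φ z) • (1 : M4) + Real.cos (φ z) • Li := by
    simp only [expLi, add_mul, smul_mul_assoc, one_mul, Li_mul_Li]
    module
  rw [hr]
  ext i j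
  simp only [matD, expLi, Matrix.of_apply, Matrix.add_apply, Matrix.smul_apply, smul_eq_mul]
  rw [fderiv_fun_add (hφ.cos.mul_const _) (hφ.sin.mul_const _), fderiv_mul_const hφ.cos,
    fderiv_mul_const hφ.sin, fderiv_cos hφ, fderiv_sin hφ]
  simp only [_root_.add_apply, _root_.smul_apply, smul_eq_mul]
  ring

theorem smoothOn_expLi {Ω : Set ℂ} {φ : ℂ → ℝ} (hφ : ContDiffOn ℝ ∞ φ Ω) :
    SmoothOn Ω fun w => expLi (φ w) := fun i j => by
  simp only [expLi, Matrix.add_apply, Matrix.smul_apply, smul_eq_mul]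
  exact (hφ.cos.mul contDiffOn_const).add (hφ.sin.mul contDiffOn_const)

theorem transpose_mul_Li {G : M4} (hG : G * Li = Li * G) : Gᵀ * Li = Li * Gᵀ := by
  have := congrArg Matrix.transpose hG
  simpa [Matrix.transpose_mul, Li_transpose] using this.symm

/-- The `L_i` component of the Maurer-Cartan form of the associated frame. -/
noncomputable def rotateForm (c s : ℝ) (a : ℂ → ℂ → ℝ) (z v : ℂ) : ℝ :=
  ((c ^ 2 - s ^ 2) * v.re + 2 * c * s * v.im) * a z 1
    + ((c ^ 2 - s ^ 2) * v.im - 2 * c * s * v.re) * a z Complex.I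

/-- The rotated form is a combination, with constant coefficients, of `a` and its Hodge dual. The
first is coclosed by `hdiv`, the second because `a` is closed. -/
theorem divForm_rotateForm {Ω : Set ℂ} (hΩ : IsOpen Ω) {a : ℂ → ℂ → ℝ}
    (ha : ∀ v, ContDiffOn ℝ ∞ (fun z => a z v) Ω) {z : ℂ} (hz : z ∈ Ω)
    (hcl : fderiv ℝ (fun w => a w Complex.I) z 1 = fderiv ℝ (fun w => a w 1) z Complex.I)
    (hdiv : divForm a z = 0) (c s : ℝ) : divForm (rotateForm c s a) z = 0 := by
  have d1 := differentiableAt_of_contDiffOn (ha 1) hΩ hz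
  have d2 := differentiableAt_of_contDiffOn (ha Complex.I) hΩ hz
  have hd : ∀ x y : ℝ, ∀ v, fderiv ℝ (fun w => x * a w 1 + y * a w Complex.I) z v =
      x * fderiv ℝ (fun w => a w 1) z v + y * fderiv ℝ (fun w => a w Complex.I) z v :=
    fun x y v => by
    rw [fderiv_fun_add (d1.const_mul x) (d2.const_mul y), fderiv_const_mul d1,
      fderiv_const_mul d2]
    rfl
  simp only [divForm, rotateForm, hd] at hdiv ⊢
  simp only [Complex.one_re, Complex.one_im, Complex.I_re, Complex.I_im]
  linear_combination (c ^ 2 - s ^ 2) * hdiv - 2 * c * s * hcl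

namespace IsFrame

variable {Ω : Set ℂ} {F : ℂ → M4} {X : ℂ → V4} {a b₁ b₂ b₃ : ℂ → ℂ → ℝ} {u : ℂ → V4}

/-- The frame associated to the parameter `c + s i` of the unit circle. -/
theorem exists_associated (h : IsFrame Ω F X a b₁ b₂ b₃ u) (hΩ : IsOpen Ω)
    (hsc : IsSimplyConnected Ω)
    (hlin : ∀ z ∈ Ω, ∀ v : ℂ, a z v = v.re * a z 1 + v.im * a z Complex.I)
    (hdiv : ∀ z ∈ Ω, divForm a z = 0) {z₀ : ℂ} (hz₀ : z₀ ∈ Ω) {c s : ℝ}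
    (hcs : c ^ 2 + s ^ 2 = 1) :
    ∃ (F' : ℂ → M4) (X' : ℂ → V4), F' z₀ = 1 ∧ X' z₀ = 0 ∧
      IsFrame Ω F' X' (rotateForm c s a) b₁ b₂ b₃ fun z => c • u z - s • (Lj *ᵥ u z) := by
  have s1 := h.smooth_a 1
  have s2 := h.smooth_a Complex.I
  -- `φ` is a primitive of `rotateForm c s a - a`, whose closedness uses both the closedness and the
  -- coclosedness of `a`.
  obtain ⟨φ, hφ, hφ₀, hφd⟩ := exists_smooth_primitive hΩ hsc
    (p := fun z => (c ^ 2 - s ^ 2 - 1) * a z 1 + (-(2 * c * s)) * a z Complex.I)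
    (q := fun z => (2 * c * s) * a z 1 + (c ^ 2 - s ^ 2 - 1) * a z Complex.I)
    ((contDiffOn_const.mul s1).add (contDiffOn_const.mul s2))
    ((contDiffOn_const.mul s1).add (contDiffOn_const.mul s2))
    (fun z hz => by
      have d1 := differentiableAt_of_contDiffOn s1 hΩ hz
      have d2 := differentiableAt_of_contDiffOn s2 hΩ hz
      have hd := hdiv z hz
      rw [fderiv_fun_add (d1.const_mul _) (d2.const_mul _), fderiv_const_mul d1,
        fderiv_const_mul d2, fderiv_fun_add (d1.const_mul _) (d2.const_mul _),
        fderiv_const_mul d1, fderiv_const_mul d2]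
      simp only [_root_.add_apply, _root_.smul_apply, smul_eq_mul]
      rw [divForm] at hd
      linear_combination (c ^ 2 - s ^ 2 - 1) * h.closed hΩ hz + 2 * c * s * hd) z₀
  let C : M4 := (F z₀)ᵀ
  have hC : Cᵀ * C = 1 := by
    rw [Matrix.transpose_transpose, mul_eq_one_comm]
    exact h.orthogonal z₀ hz₀
  have hCL : C * Li = Li * C := transpose_mul_Li (h.commute z₀ hz₀)
  -- Because `F` commutes with `L_i`, left multiplication of `F` by `M` only adds `dφ L_i` to the
  -- linear part of its Maurer–Cartan form. The constant factor `C = F(z₀)⁻¹` gives the new frame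
  -- the value `1` at `z₀`.
  let M : ℂ → M4 := fun z => expLi (φ z) * C
  have sM : SmoothOn Ω M := smoothOn_mul (smoothOn_expLi hφ) (smoothOn_const C)
  have hML : ∀ z, M z * Li = Li * M z := fun z => by
    simp only [M]
    rw [mul_assoc, hCL, ← mul_assoc, expLi_mul_Li, mul_assoc]
  have hMo : ∀ z, (M z)ᵀ * M z = 1 := fun z => by
    simp only [M, Matrix.transpose_mul]
    rw [mul_assoc, ← mul_assoc _ (expLi (φ z)), expLi_transpose_mul_self, one_mul, hC]
  have hMd : ∀ z ∈ Ω, ∀ v, matD M z v = fderiv ℝ φ z v • (M z * Li) := fun z hz v => by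
    have hconst : matD (fun _ => C) z v = 0 := by ext i j; simp [matD]
    rw [matD_mul (B := fun _ => C) (fun i j => (smoothOn_expLi hφ).differentiableAt hΩ hz i j)
      (fun i j => differentiableAt_const _), hconst, mul_zero, add_zero,
      matD_expLi (differentiableAt_of_contDiffOn hφ hΩ hz), smul_mul_assoc, mul_assoc, ← hCL,
      ← mul_assoc]
  have sX : ContDiffOn ℝ ∞ (dX X) Ω := contDiffOn_fderiv_apply h.smooth_X hΩ 1
  have sY : ContDiffOn ℝ ∞ (dY X) Ω := contDiffOn_fderiv_apply h.smooth_X hΩ Complex.I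
  have hcomb : ∀ x y : ℝ, ContDiffOn ℝ ∞ (fun z => x • dX X z + y • dY X z) Ω := fun x y =>
    (sX.const_smul x).add (sY.const_smul y)
  have hMX : ∀ x y : ℝ, ∀ z ∈ Ω, ∀ v,
      fderiv ℝ (fun w => M w *ᵥ (x • dX X w + y • dY X w)) z v =
        M z *ᵥ (fderiv ℝ φ z v • (Li *ᵥ (x • dX X z + y • dY X z))
          + (x • fderiv ℝ (dX X) z v + y • fderiv ℝ (dY X) z v)) := fun x y z hz v => by
    have d1 := differentiableAt_of_contDiffOn sX hΩ hz
    have d2 := differentiableAt_of_contDiffOn sY hΩ hz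
    rw [fderiv_mulVec (fun i j => sM.differentiableAt hΩ hz i j)
      (differentiableAt_of_contDiffOn (hcomb x y) hΩ hz), hMd z hz,
      fderiv_fun_add (d1.fun_const_smul x) (d2.fun_const_smul y), fderiv_fun_const_smul d1,
      fderiv_fun_const_smul d2]
    simp only [_root_.add_apply, _root_.smul_apply, Matrix.mulVec_add, Matrix.mulVec_smul,
      Matrix.smul_mulVec, ← Matrix.mulVec_mulVec]
    module
  -- The form integrated is `v ↦ M dX(λ⁻¹ v)` with `λ = c + s i`. In its exterior derivative the
  -- terms from `dφ` cancel `s ΔX`, thanks to `c² + s² = 1`.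
  obtain ⟨X', sX', hX'₀, hX'd⟩ := exists_smooth_primitive hΩ hsc
    (p := fun z => M z *ᵥ (c • dX X z + (-s) • dY X z))
    (q := fun z => M z *ᵥ (s • dX X z + c • dY X z))
    (contDiffOn_mulVec sM (hcomb _ _)) (contDiffOn_mulVec sM (hcomb _ _))
    (fun z hz => by
      rw [hMX _ _ z hz, hMX _ _ z hz]
      congr 1
      have hlap := h.laplacian hΩ hz
      have hsymm : fderiv ℝ (dY X) z 1 = fderiv ℝ (dX X) z Complex.I :=
        fderiv_fderiv_comm h.smooth_X hΩ hz _ _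
      rw [hφd z hz, hφd z hz]
      simp only [Complex.one_re, Complex.one_im, Complex.I_re, Complex.I_im, smul_eq_mul,
        Matrix.mulVec_add, Matrix.mulVec_smul] at hlap ⊢
      ext i
      have hl := congrFun hlap i
      have hs := congrFun hsymm i
      simp only [Pi.add_apply, Pi.smul_apply, smul_eq_mul] at hl ⊢
      linear_combination s * hl + c * hs
        + (-(s * a z 1 + c * a z Complex.I) * (Li *ᵥ dX X z) i
          + (c * a z 1 - s * a z Complex.I) * (Li *ᵥ dY X z) i) * hcs) z₀
  refine ⟨fun z => M z * F z, X', ?_, hX'₀, ?_⟩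
  · change expLi (φ z₀) * (F z₀)ᵀ * F z₀ = 1
    rw [hφ₀, expLi_zero, one_mul, h.orthogonal z₀ hz₀]
  · have hLu : ∀ z, Lj *ᵥ (Lj *ᵥ u z) = -u z := fun z => by
      rw [Matrix.mulVec_mulVec, Lj_mul_Lj, Matrix.neg_mulVec, Matrix.one_mulVec]
    exact
    { smooth_F := smoothOn_mul sM h.smooth_F
      smooth_X := sX'
      smooth_u := (h.smooth_u.const_smul c).sub
        ((contDiffOn_mulVec (smoothOn_const Lj) h.smooth_u).const_smul s)
      smooth_a := fun v => (contDiffOn_const.mul s1).add (contDiffOn_const.mul s2)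
      smooth_b₁ := h.smooth_b₁
      smooth_b₂ := h.smooth_b₂
      smooth_b₃ := h.smooth_b₃
      orthogonal := fun z hz => by
        rw [Matrix.transpose_mul, mul_assoc, ← mul_assoc _ (M z), hMo, one_mul,
          h.orthogonal z hz]
      commute := fun z hz => by
        rw [mul_assoc, h.commute z hz, ← mul_assoc, hML, mul_assoc]
      matD_F := fun z hz v => by
        rw [matD_mul (fun i j => sM.differentiableAt hΩ hz i j)
          (fun i j => h.smooth_F.differentiableAt hΩ hz i j), hMd z hz, h.matD_F z hz,
          show rotateForm c s a z v = fderiv ℝ φ z v + a z v by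
            rw [hφd z hz, hlin z hz v, rotateForm]
            simp only [smul_eq_mul]
            ring,
          linPart_add_smul_Li, mul_add, mul_smul_comm, mul_assoc (M z) (F z) Li,
          h.commute z hz, smul_mul_assoc]
        simp only [M, mul_assoc]
      fderiv_X := fun z hz v => by
        rw [hX'd z hz, h.dX_eq hz, h.dY_eq hz]
        simp only [← Matrix.mulVec_smul, ← Matrix.mulVec_add, Matrix.mulVec_mulVec _ (M z)]
        congr 1
        simp only [Matrix.mulVec_sub, Matrix.mulVec_smul, hLu]
        module
      pos := fun z hz => by
        have h0 := dotProduct_Lj_mulVec_self (u z)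
        have h0' := h0
        rw [dotProduct_comm] at h0'
        simp only [dotProduct_sub, sub_dotProduct, dotProduct_smul, smul_dotProduct, h0, h0',
          dotProduct_Lj_mulVec_Lj_mulVec, smul_eq_mul]
        have := h.pos z hz
        linear_combination this - (u z ⬝ᵥ u z) * hcs }

end IsFrame

/-! ### From group-valued maps to frames and back -/

theorem transpose_mul_self_of_dotProduct {G : M4}
    (h : ∀ x y, (G *ᵥ x) ⬝ᵥ (G *ᵥ y) = x ⬝ᵥ y) : Gᵀ * G = 1 := by
  ext i j
  have := h (Pi.single i 1) (Pi.single j 1)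
  simpa [Matrix.mul_apply, dotProduct, Matrix.one_apply, Pi.single_apply, eq_comm] using this

/-- `⟨J G x, G y⟩ = ω(x, y) = ⟨G J x, G y⟩`, and `G y` is arbitrary. -/
theorem mul_Li_of_omega {G : M4} (h : ∀ x y, (G *ᵥ x) ⬝ᵥ (G *ᵥ y) = x ⬝ᵥ y)
    (hω : ∀ x y, omega (G *ᵥ x) (G *ᵥ y) = omega x y) : G * Li = Li * G := by
  have ho := transpose_mul_self_of_dotProduct h
  refine Matrix.ext_of_mulVec_single fun i => ?_
  refine dotProduct_eq _ _ fun y => ?_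
  have hy : G *ᵥ (Gᵀ *ᵥ y) = y := by
    rw [Matrix.mulVec_mulVec, mul_eq_one_comm.1 ho, Matrix.one_mulVec]
  rw [← hy, ← Matrix.mulVec_mulVec, ← Matrix.mulVec_mulVec, h]
  exact (hω _ _).symm

theorem affine_mem_groupG {G : M4} {T : V4} (hG : Gᵀ * G = 1) (hGL : G * Li = Li * G) :
    affine G T ∈ groupG :=
  ⟨G, T, rfl, mulVec_dotProduct_mulVec_of_orthogonal hG, omega_mulVec_mulVec hG hGL⟩

theorem eq_affine_of_mem_groupG {A : M5 ℝ} (hA : A ∈ groupG) :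
    A = affine A.toBlocks₁₁ (transl A) ∧ A.toBlocks₁₁ᵀ * A.toBlocks₁₁ = 1 ∧
      A.toBlocks₁₁ * Li = Li * A.toBlocks₁₁ := by
  obtain ⟨G, T, rfl, h, hω⟩ := hA
  exact ⟨by simp [affine, transl], transpose_mul_self_of_dotProduct h, mul_Li_of_omega h hω⟩

theorem inv_mul_self_of_mem_groupG {A : M5 ℝ} (hA : A ∈ groupG) : A⁻¹ * A = 1 := by
  obtain ⟨h, ho, -⟩ := eq_affine_of_mem_groupG hA
  refine Matrix.nonsing_inv_mul A ?_
  rw [h, affine, Matrix.det_fromBlocks_zero₂₁, Matrix.det_one, mul_one]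
  have := congrArg Matrix.det ho
  rw [Matrix.det_mul, Matrix.det_one] at this
  exact IsUnit.of_mul_eq_one_right _ this

theorem eq_lieElt_of_mem_lieG {A : M5 ℝ} (hA : A ∈ lieG) :
    A = lieElt ((A (.inl 1) (.inl 0) + A (.inl 3) (.inl 2)) / 2)
      ((A (.inl 1) (.inl 0) - A (.inl 3) (.inl 2)) / 2) (A (.inl 2) (.inl 0))
      (A (.inl 3) (.inl 0)) (transl A) := by
  obtain ⟨a, b₁, b₂, b₃, t, hA⟩ := hA
  change A = lieElt a b₁ b₂ b₃ t at hA
  have h1 : A (.inl 1) (.inl 0) = a + b₁ := by simp [hA, lieElt, linPart_apply]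
  have h2 : A (.inl 3) (.inl 2) = a - b₁ := by simp [hA, lieElt, linPart_apply]
  have h3 : A (.inl 2) (.inl 0) = b₂ := by simp [hA, lieElt, linPart_apply]
  have h4 : A (.inl 3) (.inl 0) = b₃ := by simp [hA, lieElt, linPart_apply]
  have h5 : transl A = t := by ext i; simp [hA, lieElt, transl]
  rw [h1, h2, h3, h4, h5, hA]
  congr 1 <;> ring

theorem affine_mul_lieElt (G : M4) (T : V4) (a b₁ b₂ b₃ : ℝ) (t : V4) :
    affine G T * lieElt a b₁ b₂ b₃ t = Matrix.fromBlocks (G * linPart a b₁ b₂ b₃)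
      (Matrix.of fun i _ => (G *ᵥ t) i) 0 0 := by
  rw [affine, lieElt, Matrix.fromBlocks_multiply]
  congr 1
  · simp
  · ext i j; simp [Matrix.mul_apply, Matrix.mulVec, dotProduct]
  · simp
  · simp

theorem matD_affine {F : ℂ → M4} {X : ℂ → V4} {z : ℂ} (hX : DifferentiableAt ℝ X z) (v : ℂ) :
    matD (fun w => affine (F w) (X w)) z v = Matrix.fromBlocks (matD F z v)
      (Matrix.of fun i _ => fderiv ℝ X z v i) 0 0 := by
  ext (i | i) (j | j)
  · simp [matD, affine]
  · simp [matD, affine, fderiv_apply_coord hX]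
  · simp [matD, affine]
  · simp [matD, affine]

theorem rightMul_groupG0_eps3 {K : M4} (hK : K ∈ groupG0) :
    K *ᵥ eps3 = Lj *ᵥ (K *ᵥ eps1) := by
  obtain ⟨q, -, rfl⟩ := hK
  exact rightMul_mulVec_eps3 q

theorem groupG0_mulVec_eps1_dotProduct {K : M4} (hK : K ∈ groupG0) :
    (K *ᵥ eps1) ⬝ᵥ (K *ᵥ eps1) = 1 := by
  obtain ⟨q, hq, rfl⟩ := hK
  exact (rightMul_mulVec_eps1_dotProduct q).trans hq

theorem toC_injective : Function.Injective toC := fun A B h => by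
  ext i j
  have := congrFun (congrFun h i) j
  simpa [toC] using this

theorem toC_mul (A B : M5 ℝ) : toC (A * B) = toC A * toC B :=
  Matrix.map_mul (f := Complex.ofRealHom)

/-- Maps into the group with the same Maurer-Cartan form and the same value at a point agree. -/
theorem eqOn_of_matD_eq {Ω : Set ℂ} (hΩ : IsOpen Ω) (hc : IsPreconnected Ω) {z₀ : ℂ}
    (hz₀ : z₀ ∈ Ω) {W U : ℂ → M5 ℝ} {a b₁ b₂ b₃ : ℂ → ℂ → ℝ} {t : ℂ → ℂ → V4}
    (hW : SmoothOn Ω W) (hU : SmoothOn Ω U) (hWG : ∀ z ∈ Ω, W z ∈ groupG)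
    (hUG : ∀ z ∈ Ω, U z ∈ groupG)
    (hWd : ∀ z ∈ Ω, ∀ v, matD W z v = W z * lieElt (a z v) (b₁ z v) (b₂ z v) (b₃ z v) (t z v))
    (hUd : ∀ z ∈ Ω, ∀ v, matD U z v = U z * lieElt (a z v) (b₁ z v) (b₂ z v) (b₃ z v) (t z v))
    (h₀ : W z₀ = U z₀) : Set.EqOn W U Ω := by
  have hblocks : ∀ {Y : ℂ → M5 ℝ}, (∀ z ∈ Ω, Y z ∈ groupG) → (∀ z ∈ Ω, ∀ v, matD Y z v =
      Y z * lieElt (a z v) (b₁ z v) (b₂ z v) (b₃ z v) (t z v)) → ∀ z ∈ Ω, ∀ v,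
      matD Y z v = Matrix.fromBlocks
        ((Y z).toBlocks₁₁ * linPart (a z v) (b₁ z v) (b₂ z v) (b₃ z v))
        (Matrix.of fun i _ => ((Y z).toBlocks₁₁ *ᵥ t z v) i) 0 0 := fun hG hd z hz v => by
    rw [hd z hz v, (eq_affine_of_mem_groupG (hG z hz)).1, affine_mul_lieElt]
    simp [affine]
  have hWb := hblocks hWG hWd
  have hUb := hblocks hUG hUd
  have hlin : ∀ {Y : ℂ → M5 ℝ}, (∀ z ∈ Ω, ∀ v, matD Y z v = Matrix.fromBlocks
        ((Y z).toBlocks₁₁ * linPart (a z v) (b₁ z v) (b₂ z v) (b₃ z v))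
        (Matrix.of fun i _ => ((Y z).toBlocks₁₁ *ᵥ t z v) i) 0 0) → ∀ z ∈ Ω, ∀ v,
      matD (fun w => (Y w).toBlocks₁₁) z v
        = (Y z).toBlocks₁₁ * linPart (a z v) (b₁ z v) (b₂ z v) (b₃ z v) := fun hb z hz v => by
    have := congrArg Matrix.toBlocks₁₁ (hb z hz v)
    rw [Matrix.toBlocks_fromBlocks₁₁] at this
    exact this
  -- The linear part of the Lie algebra is skew-symmetric, so the derivative of this product
  -- vanishes.
  have hF : ∀ z ∈ Ω, (W z).toBlocks₁₁ * (U z).toBlocks₁₁ᵀ = 1 := fun z hz => by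
    have dW : ∀ z ∈ Ω, ∀ i j, DifferentiableAt ℝ (fun w => (W w).toBlocks₁₁ i j) z :=
      fun z hz i j => hW.differentiableAt hΩ hz (.inl i) (.inl j)
    have dU : ∀ z ∈ Ω, ∀ i j, DifferentiableAt ℝ (fun w => (U w).toBlocks₁₁ᵀ i j) z :=
      fun z hz i j => hU.differentiableAt hΩ hz (.inl j) (.inl i)
    have hd : ∀ z ∈ Ω, ∀ v, matD (fun w => (W w).toBlocks₁₁ * (U w).toBlocks₁₁ᵀ) z v = 0 :=
      fun z hz v => by
      have ht : matD (fun w => (U w).toBlocks₁₁ᵀ) z v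
          = (matD (fun w => (U w).toBlocks₁₁) z v)ᵀ := rfl
      rw [matD_mul (dW z hz) (dU z hz), hlin hWb z hz, ht, hlin hUb z hz, Matrix.transpose_mul,
        linPart_transpose, neg_mul, mul_neg, mul_assoc, add_neg_cancel]
    ext i j
    have hconst := hΩ.is_const_of_fderiv_eq_zero hc
      (f := fun w => ((W w).toBlocks₁₁ * (U w).toBlocks₁₁ᵀ) i j)
      (fun p hp => by
        simp only [Matrix.mul_apply]
        exact (DifferentiableAt.fun_sum fun k _ =>
          (dW p hp i k).fun_mul (dU p hp k j)).differentiableWithinAt)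
      (fun p hp => by
        ext v
        exact congrFun (congrFun (hd p hp v) i) j) hz hz₀
    rw [hconst, h₀, mul_eq_one_comm.1 (eq_affine_of_mem_groupG (hUG z₀ hz₀)).2.1]
  have hF' : ∀ z ∈ Ω, (W z).toBlocks₁₁ = (U z).toBlocks₁₁ := fun z hz => by
    have h1 := congrArg (· * (U z).toBlocks₁₁) (hF z hz)
    simp only [mul_assoc, one_mul] at h1
    rwa [(eq_affine_of_mem_groupG (hUG z hz)).2.1, mul_one] at h1
  -- Once the linear parts agree, the translations have the same derivative.
  have hX : ∀ z ∈ Ω, transl (W z) = transl (U z) := fun z hz => by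
    ext i
    have hdW : ∀ p ∈ Ω, DifferentiableAt ℝ (fun w => transl (W w) i) p := fun p hp =>
      hW.differentiableAt hΩ hp (.inl i) (.inr ())
    have hdU : ∀ p ∈ Ω, DifferentiableAt ℝ (fun w => transl (U w) i) p := fun p hp =>
      hU.differentiableAt hΩ hp (.inl i) (.inr ())
    have hconst := hΩ.is_const_of_fderiv_eq_zero hc (𝕜 := ℝ)
      (f := fun w => transl (W w) i - transl (U w) i)
      (fun p hp => ((hdW p hp).fun_sub (hdU p hp)).differentiableWithinAt)
      (fun p hp => by
        ext v
        have e1 := congrFun (congrFun (hWb p hp v) (.inl i)) (.inr ())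
        have e2 := congrFun (congrFun (hUb p hp v) (.inl i)) (.inr ())
        have e1' : fderiv ℝ (fun w => transl (W w) i) p v = _ := e1
        have e2' : fderiv ℝ (fun w => transl (U w) i) p v = _ := e2
        rw [fderiv_fun_sub (hdW p hp) (hdU p hp), _root_.sub_apply, e1', e2']
        simp [hF' p hp]) hz hz₀
    simp only [h₀, sub_self] at hconst
    linarith
  intro z hz
  rw [(eq_affine_of_mem_groupG (hWG z hz)).1, (eq_affine_of_mem_groupG (hUG z hz)).1, hF' z hz,
    hX z hz]

/-- The frame of a lifted conformal Lagrangian immersion. -/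
theorem IsLCLI.isFrame {Ω : Set ℂ} (hΩ : IsOpen Ω) {z₁ : ℂ} {U : ℂ → M5 ℝ} (hU : IsLCLI Ω z₁ U)
    {α : ℂ → ℂ →ₗ[ℝ] M5 ℝ} (hαsmooth : ∀ v : ℂ, SmoothOn Ω (fun z => α z v))
    (hαlie : ∀ z ∈ Ω, ∀ v : ℂ, α z v ∈ lieG)
    (hα : ∀ z ∈ Ω, ∀ v : ℂ, α z v = maurerCartan U z v) :
    IsFrame Ω (fun z => (U z).toBlocks₁₁) (fun z => transl (U z))
      (fun z v => (α z v (.inl 1) (.inl 0) + α z v (.inl 3) (.inl 2)) / 2)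
      (fun z v => (α z v (.inl 1) (.inl 0) - α z v (.inl 3) (.inl 2)) / 2)
      (fun z v => α z v (.inl 2) (.inl 0)) (fun z v => α z v (.inl 3) (.inl 0))
      (fun z => transl (α z 1)) := by
  obtain ⟨f, K, hf, hK, hKG, ht⟩ := hU.translation
  have sX : ContDiffOn ℝ ∞ (fun z => transl (U z)) Ω :=
    contDiffOn_pi.2 fun i => hU.smooth (.inl i) (.inr ())
  have hu : ∀ z ∈ Ω, transl (α z 1) = Real.exp (f z) • (K z *ᵥ eps1) := fun z hz => by
    rw [hα z hz, ht z hz]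
    simp
  have htv : ∀ z ∈ Ω, ∀ v, transl (α z v)
      = v.re • transl (α z 1) + v.im • (Lj *ᵥ transl (α z 1)) := fun z hz v => by
    rw [hu z hz, hα z hz, ht z hz, rightMul_groupG0_eps3 (hKG z hz), Matrix.mulVec_smul]
    module
  have hd : ∀ z ∈ Ω, ∀ v, matD U z v = Matrix.fromBlocks ((U z).toBlocks₁₁ *
      linPart ((α z v (.inl 1) (.inl 0) + α z v (.inl 3) (.inl 2)) / 2)
        ((α z v (.inl 1) (.inl 0) - α z v (.inl 3) (.inl 2)) / 2)
        (α z v (.inl 2) (.inl 0)) (α z v (.inl 3) (.inl 0)))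
      (Matrix.of fun i _ => ((U z).toBlocks₁₁ *ᵥ transl (α z v)) i) 0 0 := fun z hz v => by
    have h1 : matD U z v = U z * α z v := by
      rw [hα z hz, maurerCartan, ← mul_assoc,
        mul_eq_one_comm.1 (inv_mul_self_of_mem_groupG (hU.mem z hz)), one_mul]
    rw [eq_lieElt_of_mem_lieG (hαlie z hz v), (eq_affine_of_mem_groupG (hU.mem z hz)).1,
      affine_mul_lieElt] at h1
    exact h1
  exact
  { smooth_F := fun i j => hU.smooth (.inl i) (.inl j)
    smooth_X := sX
    smooth_u := contDiffOn_pi.2 fun i => hαsmooth 1 (.inl i) (.inr ())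
    smooth_a := fun v => ((hαsmooth v _ _).add (hαsmooth v _ _)).div_const 2
    smooth_b₁ := fun v => ((hαsmooth v _ _).sub (hαsmooth v _ _)).div_const 2
    smooth_b₂ := fun v => hαsmooth v _ _
    smooth_b₃ := fun v => hαsmooth v _ _
    orthogonal := fun z hz => (eq_affine_of_mem_groupG (hU.mem z hz)).2.1
    commute := fun z hz => (eq_affine_of_mem_groupG (hU.mem z hz)).2.2
    matD_F := fun z hz v => by
      have := congrArg Matrix.toBlocks₁₁ (hd z hz v)
      rw [Matrix.toBlocks_fromBlocks₁₁] at this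
      exact this
    fderiv_X := fun z hz v => by
      rw [← htv z hz v]
      ext i
      rw [fderiv_apply_coord (differentiableAt_of_contDiffOn sX hΩ hz)]
      exact congrFun (congrFun (hd z hz v) (.inl i)) (.inr ())
    pos := fun z hz => by
      rw [hu z hz, smul_dotProduct, dotProduct_smul, groupG0_mulVec_eps1_dotProduct (hKG z hz)]
      simp only [smul_eq_mul, mul_one]
      positivity }

theorem IsFrame.matD_affine {Ω : Set ℂ} {F : ℂ → M4} {X : ℂ → V4} {a b₁ b₂ b₃ : ℂ → ℂ → ℝ}
    {u : ℂ → V4} (h : IsFrame Ω F X a b₁ b₂ b₃ u) (hΩ : IsOpen Ω) {z : ℂ} (hz : z ∈ Ω) (v : ℂ) :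
    matD (fun w => affine (F w) (X w)) z v = affine (F z) (X z) *
      lieElt (a z v) (b₁ z v) (b₂ z v) (b₃ z v) (v.re • u z + v.im • (Lj *ᵥ u z)) := by
  rw [HSLag.matD_affine (differentiableAt_of_contDiffOn h.smooth_X hΩ hz), affine_mul_lieElt,
    h.matD_F z hz, h.fderiv_X z hz]

theorem IsFrame.smoothOn_affine {Ω : Set ℂ} {F : ℂ → M4} {X : ℂ → V4} {a b₁ b₂ b₃ : ℂ → ℂ → ℝ}
    {u : ℂ → V4} (h : IsFrame Ω F X a b₁ b₂ b₃ u) : SmoothOn Ω fun z => affine (F z) (X z) := by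
  rintro (i | i) (j | j)
  · exact h.smooth_F i j
  · exact contDiffOn_pi.1 h.smooth_X i
  · simpa [affine] using contDiffOn_const
  · simpa [affine] using contDiffOn_const

end HSLag

/-! ### The associated family of a Hamiltonian stationary lift -/

theorem corollary1 (Ω : Set ℂ) (hΩ : IsOpen Ω) (hsc : IsSimplyConnected Ω)
    (α : ℂ → ℂ →ₗ[ℝ] HSLag.M5 ℝ)
    (hαsmooth : ∀ v : ℂ, HSLag.SmoothOn Ω (fun z => α z v))
    (hαlie : ∀ z ∈ Ω, ∀ v : ℂ, α z v ∈ HSLag.lieG)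
    (hα : ∃ z₁ ∈ Ω, ∃ U : ℂ → HSLag.M5 ℝ,
      HSLag.IsLCLI Ω z₁ U ∧
      HSLag.IsHamiltonianStationary Ω (fun z => HSLag.transl (U z)) ∧
      ∀ z ∈ Ω, ∀ v : ℂ, α z v = HSLag.maurerCartan U z v)
    (z₀ : ℂ) (hz₀ : z₀ ∈ Ω) (lam : Circle) :
    ∃ U : ℂ → HSLag.M5 ℝ,
      HSLag.IsLCLI Ω z₀ U ∧
      (∀ z ∈ Ω, ∀ v : ℂ, HSLag.toC (HSLag.matD U z v)
        = HSLag.toC (U z) * HSLag.extended (lam : ℂ) (α z) v) ∧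
      U z₀ = 1 ∧
      (∀ W : ℂ → HSLag.M5 ℝ,
        HSLag.SmoothOn Ω W → (∀ z ∈ Ω, W z ∈ HSLag.groupG) →
        (∀ z ∈ Ω, ∀ v : ℂ, HSLag.toC (HSLag.matD W z v)
          = HSLag.toC (W z) * HSLag.extended (lam : ℂ) (α z) v) →
        W z₀ = 1 → Set.EqOn W U Ω) ∧
      HSLag.IsConformalLagrangianImmersion Ω (fun z => HSLag.transl (U z)) ∧
      HSLag.IsHamiltonianStationary Ω (fun z => HSLag.transl (U z)) := by
  open HSLag in
  obtain ⟨z₁, -, U₁, hU₁, hstat, hmc⟩ := hα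
  have hfr := hU₁.isFrame hΩ hαsmooth hαlie hmc
  obtain ⟨f, K, hf, hK, hKG, ht⟩ := hU₁.translation
  have hu : ∀ z ∈ Ω, transl (α z 1) = Real.exp (f z) • (K z *ᵥ eps1) := fun z hz => by
    rw [hmc z hz, ht z hz]
    simp
  have hlie : ∀ z ∈ Ω, ∀ v, α z v = lieElt
      ((α z v (.inl 1) (.inl 0) + α z v (.inl 3) (.inl 2)) / 2)
      ((α z v (.inl 1) (.inl 0) - α z v (.inl 3) (.inl 2)) / 2)
      (α z v (.inl 2) (.inl 0)) (α z v (.inl 3) (.inl 0))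
      (v.re • transl (α z 1) + v.im • (Lj *ᵥ transl (α z 1))) := fun z hz v => by
    have htv : transl (α z v)
        = v.re • transl (α z 1) + v.im • (Lj *ᵥ transl (α z 1)) := by
      rw [hu z hz, hmc z hz, ht z hz, rightMul_groupG0_eps3 (hKG z hz), Matrix.mulVec_smul]
      module
    rw [← htv]
    exact eq_lieElt_of_mem_lieG (hαlie z hz v)
  let a : ℂ → ℂ → ℝ := fun z v => (α z v (.inl 1) (.inl 0) + α z v (.inl 3) (.inl 2)) / 2
  have hlin : ∀ z ∈ Ω, ∀ v : ℂ, a z v = v.re * a z 1 + v.im * a z Complex.I := fun z _ v => by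
    have hv : α z v = v.re • α z 1 + v.im • α z Complex.I := by
      conv_lhs => rw [show v = v.re • (1 : ℂ) + v.im • Complex.I by
        apply Complex.ext <;> simp]
      rw [map_add, map_smul, map_smul]
    simp only [a, hv, Matrix.add_apply, Matrix.smul_apply, smul_eq_mul]
    ring
  have hdiv : ∀ z ∈ Ω, divForm a z = 0 := (hfr.isHamiltonianStationary_iff hΩ).1 hstat
  let c : ℝ := (lam : ℂ).re
  let s : ℝ := (lam : ℂ).im
  have hcs : c ^ 2 + s ^ 2 = 1 := by
    have := Circle.normSq_coe lam
    rw [Complex.normSq_apply] at this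
    linarith
  obtain ⟨F, X, hF₀, hX₀, hfr'⟩ := hfr.exists_associated hΩ hsc hlin hdiv hz₀ hcs
  have hinv : (lam : ℂ)⁻¹ = c - s * Complex.I := by
    rw [← Circle.coe_inv, Circle.coe_inv_eq_conj]
    apply Complex.ext <;> simp [c, s]
  have hext : ∀ z ∈ Ω, ∀ v, extended lam (α z) v = toC (lieElt (rotateForm c s a z v)
      ((α z v (.inl 1) (.inl 0) - α z v (.inl 3) (.inl 2)) / 2)
      (α z v (.inl 2) (.inl 0)) (α z v (.inl 3) (.inl 0))
      (v.re • (c • transl (α z 1) - s • (Lj *ᵥ transl (α z 1)))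
        + v.im • (Lj *ᵥ (c • transl (α z 1) - s • (Lj *ᵥ transl (α z 1)))))) := fun z hz v => by
    rw [extended_eq (hlie z hz) v rfl rfl
      (by rw [← Circle.coe_inv_eq_conj, Circle.coe_inv])]
    have h1 : ((lam : ℂ)⁻¹ * v).re = c * v.re + s * v.im := by rw [hinv]; simp
    have h2 : ((lam : ℂ)⁻¹ * v).im = c * v.im - s * v.re := by rw [hinv]; simp; ring
    have h3 : ((lam : ℂ)⁻¹ * ((lam : ℂ)⁻¹ * v)).re
        = (c ^ 2 - s ^ 2) * v.re + 2 * c * s * v.im := by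
      rw [hinv, Complex.mul_re, ← hinv, h1, h2, hinv]; simp; ring
    have h4 : ((lam : ℂ)⁻¹ * ((lam : ℂ)⁻¹ * v)).im
        = (c ^ 2 - s ^ 2) * v.im - 2 * c * s * v.re := by
      rw [hinv, Complex.mul_im, ← hinv, h1, h2, hinv]; simp; ring
    rw [h1, h2, h3, h4]
    congr 2
    simp only [Matrix.mulVec_sub, Matrix.mulVec_smul, Matrix.mulVec_mulVec _ Lj, Lj_mul_Lj,
      Matrix.neg_mulVec, Matrix.one_mulVec]
    module
  have hmem : ∀ z ∈ Ω, affine (F z) (X z) ∈ groupG := fun z hz =>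
    affine_mem_groupG (hfr'.orthogonal z hz) (hfr'.commute z hz)
  have hbase : affine (F z₀) (X z₀) = 1 := by
    rw [hF₀, hX₀, affine, ← Matrix.fromBlocks_one]
    rfl
  have hmatD := fun z (hz : z ∈ Ω) v => hfr'.matD_affine hΩ hz v
  -- The conformal factor `f` is unchanged, and `K` becomes `K (c - s R_j)`, which sends `ε₁` to `(c
  -- - s L_j) K ε₁`.
  refine ⟨fun z => affine (F z) (X z), ⟨hfr'.smoothOn_affine, hmem, hbase, f,
    fun z => c • K z - s • (K z * Rj), hf, ?_, fun z hz =>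
      smul_sub_smul_mul_Rj_mem_groupG0 (hKG z hz) hcs, fun z hz v => ?_⟩, fun z hz v => ?_,
    hbase, fun W hW hWG hWd hW₀ => ?_, hfr'.isConformalLagrangianImmersion, ?_⟩
  · intro i j
    have h1 := hK i j
    have h2 := smoothOn_mul hK (smoothOn_const Rj) i j
    simp only [Matrix.sub_apply, Matrix.smul_apply, smul_eq_mul]
    exact (contDiffOn_const.mul h1).sub (contDiffOn_const.mul h2)
  · rw [maurerCartan, hmatD z hz, ← mul_assoc, inv_mul_self_of_mem_groupG (hmem z hz), one_mul,
      rightMul_groupG0_eps3 (smul_sub_smul_mul_Rj_mem_groupG0 (hKG z hz) hcs),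
      smul_sub_smul_mul_Rj_mulVec_eps1 (hKG z hz)]
    change v.re • (c • transl (α z 1) - s • (Lj *ᵥ transl (α z 1)))
        + v.im • (Lj *ᵥ (c • transl (α z 1) - s • (Lj *ᵥ transl (α z 1)))) = _
    rw [hu z hz]
    simp only [Matrix.mulVec_sub, Matrix.mulVec_smul]
    module
  · rw [hmatD z hz, toC_mul, hext z hz]
  · refine eqOn_of_matD_eq hΩ hsc.isPathConnected.isConnected.isPreconnected hz₀ hW
      hfr'.smoothOn_affine hWG hmem (fun z hz v => ?_) hmatD (hW₀.trans hbase.symm)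
    apply toC_injective
    rw [hWd z hz, toC_mul, hext z hz]
  · exact (hfr'.isHamiltonianStationary_iff hΩ).2 fun z hz =>
      divForm_rotateForm hΩ hfr.smooth_a hz (hfr.closed hΩ hz) (hdiv z hz) c s
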